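/- Let $(X,\omega,g,J)$ be a Kähler manifold of complex dimension $4$ (not necessarily compact), with $\omega(u,v)=g(Ju,v)$, let $L\to X$ be a smooth complex line bundle with a smooth Hermitian metric $h$, and let $\nabla$ be a (smooth) Hermitian connection of $(L,h)$. Its curvature $F$ is the $\sqrt{-1}\,\mathbb R$-valued $2$-form on $X$ with $\nabla_U\nabla_Vs-\nabla_V\nabla_Us-\nabla_{[U,V]}s=F(U,V)s$. Conventions. At each point, $|\cdot|$ is the norm on complex-valued $k$-forms (the Hermitian extension of the one induced by $g$) for which the forms $e^{i_1}\wedge\dots\wedge e^{i_k}$, $i_1<\dots<i_k$, are orthonormal whenever $(e^i)$ is a $g$-orthonormal coframe. For $p\neq q$, $[[\Lambda^{p,q}]]$ is the space of real forms in $\Lambda^{p,q}\oplus\Lambda^{q,p}$, and $\pi^{[[p,q]]}$ is the orthogonal projection onto it, extended $\mathbb C$-linearly to complex-valued forms. The endomorphism $(-\sqrt{-1}F)^\sharp$ of $TX$ is defined by $g\big((-\sqrt{-1}F)^\sharp u,v\big)=-\sqrt{-1}F(u,v)$, and $\det$ is the determinant of real endomorphisms of the $8$-dimensional real vector spaces $T_xX$.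 For $\theta\in\mathbb R$, $\nabla$ is called deformed Hermitian-Yang-Mills (dHYM) with phase $e^{\sqrt{-1}\theta}$ if $\pi^{[[2,0]]}(-\sqrt{-1}F)=0$ and $\operatorname{Im}\big(e^{-\sqrt{-1}\theta}(\omega+F)^4\big)=0$ on $X$. Then: 1. at every point of $X$, $$\left|\frac{(\omega+F)^4}{4!}\right|^2+2\left|\pi^{[[4,2]]}\Big(\frac{(\omega+F)^3}{3!}\Big)\right|^2+8\left|\pi^{[[4,0]]}\Big(\frac{(\omega+F)^2}{2!}\Big)\right|^2=\det\big(\mathrm{id}_{TX}+(-\sqrt{-1}F)^\sharp\big);$$ 2. for every $\theta\in\mathbb R$, at every point of $X$, $$\left|\operatorname{Re}\Big(e^{-\sqrt{-1}\theta}\frac{(\omega+F)^4}{4!}\Big)\right|\le\sqrt{\det\big(\mathrm{id}_{TX}+(-\sqrt{-1}F)^\sharp\big)},$$ and equality holds at every point of $X$ if and only if $\nabla$ is dHYM with phase $e^{\sqrt{-1}\theta}$. -/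

import Mathlib

open scoped Manifold ContDiff Bundle
open Module

noncomputable section

/-! ## Complex-valued exterior forms on a Euclidean vector space -/

section Bilinear

variable {V : Type*} [AddCommGroup V] [Module ℝ V]

/-- The `2`-form attached to a bilinear map which is alternating. -/
def altOfBilin (B : V →ₗ[ℝ] V →ₗ[ℝ] ℂ) (hB : ∀ v, B v v = 0) : V [⋀^Fin 2]→ₗ[ℝ] ℂ where
  toFun v := B (v 0) (v 1)
  map_update_add' v i a b := by
    fin_cases i <;> simp [Function.update]
  map_update_smul' v i c a := by
    fin_cases i <;> simp [Function.update]
  map_eq_zero_of_eq' v i j hv hij := by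
    have h01 : v 0 = v 1 := by
      fin_cases i <;> fin_cases j <;> simp_all
    simp [h01, hB]

end Bilinear

lemma update_vec_zero {V : Type*} (u v w : V) : Function.update ![u, v] 0 w = ![w, v] := by
  ext i; fin_cases i <;> simp

lemma update_vec_one {V : Type*} (u v w : V) : Function.update ![u, v] 1 w = ![u, w] := by
  ext i; fin_cases i <;> simp

section LinearAlgebra

variable {V : Type*} [NormedAddCommGroup V] [InnerProductSpace ℝ V]

/-- `Λᵏ V* ⊗ ℂ`: alternating `ℝ`-multilinear `k`-forms on `V` with values in `ℂ`. -/
abbrev CForm (V : Type*) [NormedAddCommGroup V] [InnerProductSpace ℝ V] (k : ℕ) : Type _ :=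
  V [⋀^Fin k]→ₗ[ℝ] ℂ

namespace CForm

/-- The wedge product, normalised so that `(e¹ ∧ e²)(e₁, e₂) = 1` for a dual basis. -/
def wedge {k l : ℕ} (α : CForm V k) (β : CForm V l) : CForm V (k + l) :=
  ((LinearMap.mul' ℝ ℂ).compAlternatingMap (α.domCoprod β)).domDomCongr finSumFinEquiv

/-- The power `αʳ = α ∧ ⋯ ∧ α` of a `2`-form. -/
def pow (α : CForm V 2) : (r : ℕ) → CForm V (2 * r)
  | 0 => AlternatingMap.constOfIsEmpty ℝ V (Fin 0) (1 : ℂ)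
  | r + 1 => wedge (pow α r) α

/-- The components of a form on the standard orthonormal basis of `V`. -/
def coeff [FiniteDimensional ℝ V] {k : ℕ} (α : CForm V k) (f : Fin k → Fin (finrank ℝ V)) : ℂ :=
  α fun i => stdOrthonormalBasis ℝ V (f i)

lemma eq_zero_of_coeff [FiniteDimensional ℝ V] {k : ℕ} (α : CForm V k)
    (h : ∀ f, α.coeff f = 0) : α = 0 := by
  refine Basis.ext_alternating (stdOrthonormalBasis ℝ V).toBasis fun v _ => ?_
  simpa [coeff] using h v

instance innerCore [FiniteDimensional ℝ V] (k : ℕ) : InnerProductSpace.Core ℂ (CForm V k) where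
  inner α β := (k.factorial : ℂ)⁻¹ * ∑ f : Fin k → Fin (finrank ℝ V),
    starRingEnd ℂ (α.coeff f) * β.coeff f
  conj_inner_symm α β := by
    simp [map_sum, mul_comm]
  re_inner_nonneg α := by
    have : ((k.factorial : ℂ)⁻¹ * ∑ f : Fin k → Fin (finrank ℝ V),
        starRingEnd ℂ (α.coeff f) * α.coeff f) =
        (((k.factorial : ℝ)⁻¹ * ∑ f : Fin k → Fin (finrank ℝ V), ‖α.coeff f‖ ^ 2 : ℝ) : ℂ) := by
      simp [← Complex.conj_mul']
    rw [this]
    simp only [RCLike.re_to_complex, Complex.ofReal_re]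
    positivity
  add_left α β γ := by
    simp [coeff, add_mul, Finset.sum_add_distrib, mul_add]
  smul_left α β r := by
    simp [coeff, Finset.mul_sum, mul_assoc, mul_left_comm]
  definite α h := by
    have h2 : ((k.factorial : ℂ)⁻¹ * ∑ f : Fin k → Fin (finrank ℝ V),
        starRingEnd ℂ (α.coeff f) * α.coeff f) =
        (((k.factorial : ℝ)⁻¹ * ∑ f : Fin k → Fin (finrank ℝ V), ‖α.coeff f‖ ^ 2 : ℝ) : ℂ) := by
      simp [← Complex.conj_mul']
    rw [h2, Complex.ofReal_eq_zero, mul_eq_zero] at h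
    have h3 := h.resolve_left (by positivity)
    rw [Finset.sum_eq_zero_iff_of_nonneg (fun _ _ => by positivity)] at h3
    exact eq_zero_of_coeff α fun f => by simpa using h3 f (Finset.mem_univ f)

/-- The norm `|α|` on `k`-forms: the Hermitian extension of the inner product induced by the
Euclidean structure of `V`, for which the `e^{i₁} ∧ ⋯ ∧ e^{iₖ}` with `i₁ < ⋯ < iₖ` are
orthonormal, `(eᵢ)` being an orthonormal basis of `V`. -/
instance [FiniteDimensional ℝ V] (k : ℕ) : NormedAddCommGroup (CForm V k) :=
  (innerCore k).toNormedAddCommGroup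

instance [FiniteDimensional ℝ V] (k : ℕ) : InnerProductSpace ℂ (CForm V k) :=
  InnerProductSpace.ofCore (innerCore k).toCore

lemma norm_sq_eq [FiniteDimensional ℝ V] {k : ℕ} (α : CForm V k) :
    ‖α‖ ^ 2 = (k.factorial : ℝ)⁻¹ * ∑ f : Fin k → Fin (finrank ℝ V), ‖α.coeff f‖ ^ 2 := by
  rw [← Complex.ofReal_inj]
  have h := inner_self_eq_norm_sq_to_K (𝕜 := ℂ) α
  have h2 : inner ℂ α α = (k.factorial : ℂ)⁻¹ * ∑ f : Fin k → Fin (finrank ℝ V),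
    starRingEnd ℂ (α.coeff f) * α.coeff f := rfl
  rw [h2] at h
  simpa [Complex.conj_mul'] using h.symm

instance [FiniteDimensional ℝ V] (k : ℕ) : FiniteDimensional ℂ (CForm V k) := by
  let T : CForm V k →ₗ[ℂ] ((Fin k → Fin (finrank ℝ V)) → ℂ) :=
    { toFun := fun α => α.coeff
      map_add' := fun _ _ => rfl
      map_smul' := fun _ _ => rfl }
  refine FiniteDimensional.of_injective T ?_
  rw [injective_iff_map_eq_zero]
  exact fun α h => eq_zero_of_coeff α fun f => congrFun h f

/-- The real part of a form, regarded as a `ℂ`-valued form with real values. -/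
def re {k : ℕ} (α : CForm V k) : CForm V k :=
  (Complex.ofRealCLM.toLinearMap ∘ₗ Complex.reLm).compAlternatingMap α

/-- The imaginary part of a form, regarded as a `ℂ`-valued form with real values. -/
def im {k : ℕ} (α : CForm V k) : CForm V k :=
  (Complex.ofRealCLM.toLinearMap ∘ₗ Complex.imLm).compAlternatingMap α

/-- The decomposable form `f₁ ∧ ⋯ ∧ fₖ`, `(v₁, …, vₖ) ↦ det (fⱼ (vᵢ))`. -/
def wedgeOne {k : ℕ} (f : Fin k → V →ₗ[ℝ] ℂ) : CForm V k where
  toFun v := (Matrix.of fun i j => f j (v i)).det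
  map_update_add' {inst} v i a b := by
    obtain rfl : inst = instDecidableEqFin k := Subsingleton.elim _ _
    have h (w : V) : (Matrix.of fun i' j => f j (Function.update v i w i')) =
        (Matrix.of fun i' j => f j (v i')).updateRow i fun j => f j w := by
      ext i' j
      by_cases hi : i' = i
      · subst hi; simp
      · simp [hi]
    rw [h, h, h, ← Matrix.det_updateRow_add]
    congr 2
    ext j; simp
  map_update_smul' {inst} v i c a := by
    obtain rfl : inst = instDecidableEqFin k := Subsingleton.elim _ _
    have h (w : V) : (Matrix.of fun i' j => f j (Function.update v i w i')) =
        (Matrix.of fun i' j => f j (v i')).updateRow i fun j => f j w := by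
      ext i' j
      by_cases hi : i' = i
      · subst hi; simp
      · simp [hi]
    rw [h, h, Complex.real_smul, ← Matrix.det_updateRow_smul]
    congr 2
    ext j; simp
  map_eq_zero_of_eq' v i j hv hij :=
    Matrix.det_zero_of_row_eq hij (by ext l; simp [hv])

/-- `Λ^{p,q} ⊆ Λᵏ V* ⊗ ℂ` (`k = p + q`) for a complex structure `J` on `V`: the span of the wedge
products of `p` one-forms of type `(1,0)` and `q` one-forms of type `(0,1)`. -/
def typeSubspace (J : V →ₗ[ℝ] V) {k : ℕ} (p q : ℕ) : Submodule ℂ (CForm V k) :=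
  Submodule.span ℂ {α | p + q = k ∧ ∃ f : Fin k → V →ₗ[ℝ] ℂ,
    (∀ i : Fin k, (i : ℕ) < p → ∀ v, f i (J v) = Complex.I * f i v) ∧
    (∀ i : Fin k, p ≤ (i : ℕ) → ∀ v, f i (J v) = -Complex.I * f i v) ∧
    α = wedgeOne f}

/-- The projection `π^{[[p,q]]}` for `p ≠ q`: the orthogonal projection of complex `k`-forms onto
`Λ^{p,q} ⊕ Λ^{q,p}`, which is the complexification of the space `[[Λ^{p,q}]]` of real forms in
`Λ^{p,q} ⊕ Λ^{q,p}`. On real forms it is the orthogonal projection onto `[[Λ^{p,q}]]`, and on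
complex forms its complex linear extension. -/
def bracketProj [FiniteDimensional ℝ V] (J : V →ₗ[ℝ] V) (p q : ℕ) {k : ℕ} (α : CForm V k) :
    CForm V k :=
  (typeSubspace J p q ⊔ typeSubspace J q p).starProjection α

/-- The bilinear map `(u, v) ↦ F(u, v)` of a `2`-form. -/
def toBilin (F : CForm V 2) : V →ₗ[ℝ] V →ₗ[ℝ] ℂ :=
  LinearMap.mk₂ ℝ (fun u v => F ![u, v])
    (fun u u' v => by simpa only [update_vec_zero] using F.map_update_add ![u, v] 0 u u')
    (fun c u v => by simpa only [update_vec_zero] using F.map_update_smul ![u, v] 0 c u)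
    (fun u v v' => by simpa only [update_vec_one] using F.map_update_add ![u, v] 1 v v')
    (fun c u v => by simpa only [update_vec_one] using F.map_update_smul ![u, v] 1 c v)

/-- For a `2`-form `F` with values in `iℝ`, the endomorphism `(-iF)^♯` of `V`, which is
`u ↦ (-i F(u, ·))^♯`, see `inner_sharp`. The real part only serves to have a real number as value:
`-iF` is real as soon as `F` is `iℝ`-valued. -/
def sharp [FiniteDimensional ℝ V] (F : CForm V 2) : V →ₗ[ℝ] V :=
  ∑ j, (Complex.reLm ∘ₗ (-Complex.I • (toBilin F).flip (stdOrthonormalBasis ℝ V j))).smulRight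
    (stdOrthonormalBasis ℝ V j)

lemma inner_sharp [FiniteDimensional ℝ V] (F : CForm V 2) (u v : V) :
    inner ℝ (sharp F u) v = (-Complex.I * F ![u, v]).re := by
  have h : (-Complex.I * F ![u, v]).re =
      (Complex.reLm ∘ₗ (-Complex.I • toBilin F u)) v := rfl
  rw [h]
  conv_rhs => rw [← (stdOrthonormalBasis ℝ V).sum_repr' v, map_sum]
  simp only [sharp, LinearMap.sum_apply, sum_inner, map_smul]
  refine Finset.sum_congr rfl fun j _ => ?_
  rw [LinearMap.smulRight_apply, real_inner_smul_left, smul_eq_mul, mul_comm]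
  rfl

end CForm
end LinearAlgebra
/-! ## Hermitian connections on complex line bundles, and their curvature -/

section Connection

set_option linter.unusedSectionVars false

open VectorField Bundle

variable {E : Type*} [NormedAddCommGroup E] [NormedSpace ℝ E]
  {X : Type*} [TopologicalSpace X] [ChartedSpace E X]

/-- `U` is a smooth vector field on `X`. -/
def SmoothField [IsManifold 𝓘(ℝ, E) 1 X] (U : (x : X) → TangentSpace 𝓘(ℝ, E) x) : Prop :=
  ContMDiff 𝓘(ℝ, E) 𝓘(ℝ, E).tangent ∞ fun x => TotalSpace.mk' E x (U x)

/-- The vector field `U` is differentiable at `x`. -/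
def DiffFieldAt [IsManifold 𝓘(ℝ, E) 1 X] (U : (x : X) → TangentSpace 𝓘(ℝ, E) x) (x : X) : Prop :=
  MDifferentiableAt 𝓘(ℝ, E) 𝓘(ℝ, E).tangent (fun x => TotalSpace.mk' E x (U x)) x

section LieDeriv

variable [IsManifold 𝓘(ℝ, E) ∞ X]

lemma mvfderiv_chart {f : X → ℝ} {x : X} {z : E}
    (hz : z ∈ (extChartAt 𝓘(ℝ, E) x).target)
    (hf : MDifferentiableAt 𝓘(ℝ, E) 𝓘(ℝ, ℝ) f ((extChartAt 𝓘(ℝ, E) x).symm z))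
    (w : TangentSpace 𝓘(ℝ, E) ((extChartAt 𝓘(ℝ, E) x).symm z)) :
    mvfderiv 𝓘(ℝ, E) f ((extChartAt 𝓘(ℝ, E) x).symm z) w =
      fderiv ℝ (f ∘ (extChartAt 𝓘(ℝ, E) x).symm) z
        ((mfderivWithin 𝓘(ℝ, E) 𝓘(ℝ, E) (extChartAt 𝓘(ℝ, E) x).symm (Set.range 𝓘(ℝ, E)) z).inverse w) := by
  have hinv := isInvertible_mfderivWithin_extChartAt_symm (I := 𝓘(ℝ, E)) hz
  have hs : MDifferentiableAt 𝓘(ℝ, E) 𝓘(ℝ, E) (extChartAt 𝓘(ℝ, E) x).symm z := by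
    have := (contMDiffWithinAt_extChartAt_symm_range (n := 1) (I := 𝓘(ℝ, E)) x hz)
    rw [modelWithCornersSelf_coe, Set.range_id, contMDiffWithinAt_univ] at this
    exact this.mdifferentiableAt one_ne_zero
  have h := mfderiv_comp z hf hs
  rw [← mfderiv_eq_fderiv, h]
  simp only [modelWithCornersSelf_coe, Set.range_id, mfderivWithin_univ] at hinv ⊢
  obtain ⟨e, he⟩ := hinv
  rw [← he]
  have h3 : e ((e : _ →L[ℝ] _).inverse w) = w := by
    rw [ContinuousLinearMap.inverse_equiv]
    exact e.apply_symm_apply w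
  exact (congrArg (mfderiv 𝓘(ℝ, E) 𝓘(ℝ, ℝ) f ((extChartAt 𝓘(ℝ, E) x).symm z)) h3).symm

lemma lie_deriv_aux [CompleteSpace E] {f : X → ℝ} {x : X}
    (hf : ContMDiffAt 𝓘(ℝ, E) 𝓘(ℝ, ℝ) ∞ f x)
    {U V : (x : X) → TangentSpace 𝓘(ℝ, E) x} (hU : DiffFieldAt U x) (hV : DiffFieldAt V x) :
    MDifferentiableAt 𝓘(ℝ, E) 𝓘(ℝ, ℝ) (fun y => mvfderiv 𝓘(ℝ, E) f y (V y)) x ∧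
    mvfderiv 𝓘(ℝ, E) f x (mlieBracket 𝓘(ℝ, E) U V x) =
      mvfderiv 𝓘(ℝ, E) (fun y => mvfderiv 𝓘(ℝ, E) f y (V y)) x (U x) -
      mvfderiv 𝓘(ℝ, E) (fun y => mvfderiv 𝓘(ℝ, E) f y (U y)) x (V x) := by
  set φ := extChartAt 𝓘(ℝ, E) x with hφ
  have hxs : x ∈ φ.source := mem_extChartAt_source x
  have hxt : φ x ∈ φ.target := mem_extChartAt_target x
  have hsymm : φ.symm (φ x) = x := extChartAt_to_inv x
  -- the fields in the chart
  let P (W : (x : X) → TangentSpace 𝓘(ℝ, E) x) : E → E :=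
    mpullbackWithin 𝓘(ℝ, E) 𝓘(ℝ, E) φ.symm W (Set.range 𝓘(ℝ, E))
  have hP {W : (x : X) → TangentSpace 𝓘(ℝ, E) x} (hW : DiffFieldAt W x) :
      DifferentiableAt ℝ (P W) (φ x) := by
    have hW' : MDifferentiableWithinAt 𝓘(ℝ, E) 𝓘(ℝ, E).tangent
      (fun x => TotalSpace.mk' E x (W x)) Set.univ x := hW.mdifferentiableWithinAt
    have := hW'.differentiableWithinAt_mpullbackWithin_vectorField
    have hr : (extChartAt 𝓘(ℝ, E) x).symm ⁻¹' Set.univ ∩ Set.range 𝓘(ℝ, E) = Set.univ := by simp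
    rw [hr] at this
    exact differentiableWithinAt_univ.1 this
  have hf2 : ContMDiffAt 𝓘(ℝ, E) 𝓘(ℝ, ℝ) 2 f x := hf.of_le ENat.LEInfty.out
  let g : E → ℝ := f ∘ φ.symm
  have hg : ContDiffAt ℝ 2 g (φ x) := by
    have h1 := (contMDiffAt_iff.1 hf2).2
    rw [modelWithCornersSelf_coe, Set.range_id] at h1
    exact contDiffWithinAt_univ.1 h1
  have hfd : ∀ᶠ y in nhds x, MDifferentiableAt 𝓘(ℝ, E) 𝓘(ℝ, ℝ) f y := by
    have := (contMDiffAt_iff_contMDiffAt_nhds (by simp)).1 hf2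
    filter_upwards [this] with y hy using hy.mdifferentiableAt (by simp)
  have hcont : ContinuousAt φ.symm (φ x) := continuousAt_extChartAt_symm x
  -- derivatives of `f` along `W` in the chart
  have hev (W : (x : X) → TangentSpace 𝓘(ℝ, E) x) :
      (fun y => mvfderiv 𝓘(ℝ, E) f y (W y)) ∘ φ.symm =ᶠ[nhds (φ x)]
        fun z => fderiv ℝ g z (P W z) := by
    have h1 : ∀ᶠ z in nhds (φ x), MDifferentiableAt 𝓘(ℝ, E) 𝓘(ℝ, ℝ) f (φ.symm z) := by
      apply hcont.eventually
      rwa [hsymm]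
    have h2 : ∀ᶠ z in nhds (φ x), z ∈ φ.target := extChartAt_target_mem_nhds x
    filter_upwards [h1, h2] with z hz1 hz2
    exact mvfderiv_chart hz2 hz1 _
  have hdg : DifferentiableAt ℝ (fderiv ℝ g) (φ x) :=
    (hg.fderiv_right (m := 1) (by norm_num)).differentiableAt one_ne_zero
  have hmd {W : (x : X) → TangentSpace 𝓘(ℝ, E) x} (hW : DiffFieldAt W x) :
      MDifferentiableAt 𝓘(ℝ, E) 𝓘(ℝ, ℝ) (fun y => mvfderiv 𝓘(ℝ, E) f y (W y)) x := by
    have h1 : DifferentiableAt ℝ (fun z => fderiv ℝ g z (P W z)) (φ x) :=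
      hdg.clm_apply (hP hW)
    have h2 := h1.congr_of_eventuallyEq (hev W)
    have h3 := DifferentiableWithinAt.mdifferentiableWithinAt_of_comp_extChartAt_symm
      (I := 𝓘(ℝ, E)) (f := fun y => mvfderiv 𝓘(ℝ, E) f y (W y)) (s := Set.univ) (x := x)
      (by
        have hr : (extChartAt 𝓘(ℝ, E) x).symm ⁻¹' Set.univ ∩ Set.range 𝓘(ℝ, E) = Set.univ := by
          simp
        rw [hr]
        exact h2.differentiableWithinAt)
    exact mdifferentiableWithinAt_univ.1 h3
  have hd {W Z : (x : X) → TangentSpace 𝓘(ℝ, E) x} (hW : DiffFieldAt W x) :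
      mvfderiv 𝓘(ℝ, E) (fun y => mvfderiv 𝓘(ℝ, E) f y (W y)) x (Z x) =
        fderiv ℝ (fun z => fderiv ℝ g z (P W z)) (φ x) (P Z (φ x)) := by
    have h1 := mvfderiv_chart (f := fun y => mvfderiv 𝓘(ℝ, E) f y (W y)) hxt
      (by rw [hsymm]; exact hmd hW) (Z (φ.symm (φ x)))
    rw [(hev W).fderiv_eq] at h1
    have h2 : mvfderiv 𝓘(ℝ, E) (fun y => mvfderiv 𝓘(ℝ, E) f y (W y)) (φ.symm (φ x))
        (Z (φ.symm (φ x))) =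
        mvfderiv 𝓘(ℝ, E) (fun y => mvfderiv 𝓘(ℝ, E) f y (W y)) x (Z x) := by rw [hsymm]
    exact h2.symm.trans h1
  refine ⟨hmd hV, ?_⟩
  rw [hd hV, hd hU]
  have h0 := fderiv_apply_lieBracket (𝕜 := ℝ) hg (by simp) (hP hV) (hP hU)
  rw [← h0]
  have h1 : ∀ w : E, mvfderiv 𝓘(ℝ, E) f x
      ((mfderiv 𝓘(ℝ, E) 𝓘(ℝ, E) φ x).inverse w) = fderiv ℝ g (φ x) w := by
    intro w
    have hinv := isInvertible_mfderiv_extChartAt (I := 𝓘(ℝ, E)) hxs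
    have hfe : f =ᶠ[nhds x] g ∘ φ := by
      filter_upwards [extChartAt_source_mem_nhds (I := 𝓘(ℝ, E)) x] with y hy
      exact congrArg f (φ.left_inv hy).symm
    have hgd : MDifferentiableAt 𝓘(ℝ, E) 𝓘(ℝ, ℝ) g (φ x) :=
      (hg.differentiableAt (by simp)).mdifferentiableAt
    have hcd : MDifferentiableAt 𝓘(ℝ, E) 𝓘(ℝ, E) φ x :=
      mdifferentiableAt_extChartAt (mem_chart_source E x)
    have hc := (hfe.mfderiv_eq (I := 𝓘(ℝ, E)) (I' := 𝓘(ℝ, ℝ))).trans (mfderiv_comp x hgd hcd)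
    obtain ⟨e, he⟩ := hinv
    rw [← he, ContinuousLinearMap.inverse_equiv]
    have h3 : mfderiv 𝓘(ℝ, E) 𝓘(ℝ, E) φ x (e.symm w) = w := by
      rw [← he]
      exact e.apply_symm_apply w
    have h4 := congrArg (mfderiv 𝓘(ℝ, E) 𝓘(ℝ, ℝ) g (φ x)) h3
    have h5 := (DFunLike.congr_fun hc (e.symm w)).trans h4
    rw [mfderiv_eq_fderiv] at h5
    exact h5
  rw [← h1, mlieBracket, mlieBracketWithin_apply, ← lieBracketWithin_univ]
  have hr : (extChartAt 𝓘(ℝ, E) x).symm ⁻¹' Set.univ ∩ Set.range 𝓘(ℝ, E) = Set.univ := by simp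
  rw [hr]

end LieDeriv

section LineBundle

variable {L : X → Type*} [TopologicalSpace (TotalSpace ℂ L)] [∀ x, NormedAddCommGroup (L x)]

/-- A complex vector bundle is in particular a real vector bundle. -/
instance realVectorBundle [∀ x, NormedSpace ℂ (L x)] [FiberBundle ℂ L] [VectorBundle ℂ ℂ L] :
    VectorBundle ℝ ℂ L where
  trivialization_linear' e _ := ⟨fun b hb =>
    { map_add := (e.linear ℂ hb).map_add
      map_smul := fun c y => by
        simpa using (e.linear ℂ hb).map_smul (c : ℂ) y }⟩
  continuousOn_coordChange' e e' _ _ := by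
    have h := VectorBundle.continuousOn_coordChange' (R := ℂ) e e'
    refine ((ContinuousLinearMap.restrictScalarsL ℂ ℂ ℂ ℝ ℝ).continuous.comp_continuousOn
      h).congr fun b hb => ?_
    ext
    simp [Trivialization.coordChangeL_apply _ _ hb]

variable [∀ x, InnerProductSpace ℂ (L x)] [FiberBundle ℂ L]

variable (E) in
/-- `s` is a smooth section of the line bundle `L`. -/
def SmoothSection (s : (x : X) → L x) : Prop :=
  ContMDiff 𝓘(ℝ, E) (𝓘(ℝ, E).prod 𝓘(ℝ, ℂ)) ∞ fun x => TotalSpace.mk' ℂ x (s x)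

variable (E) in
/-- The section `s` of the line bundle `L` is differentiable at `x`. -/
def DiffSectionAt (s : (x : X) → L x) (x : X) : Prop :=
  MDifferentiableAt 𝓘(ℝ, E) (𝓘(ℝ, E).prod 𝓘(ℝ, ℂ)) (fun x => TotalSpace.mk' ℂ x (s x)) x

variable (E) (L) in
/-- The Hermitian metric of the line bundle `L`, given by the inner products of the fibres, is
smooth. -/
def IsSmoothHermitianMetric : Prop :=
  ∀ s t : (x : X) → L x, SmoothSection E s → SmoothSection E t →
    ContMDiff 𝓘(ℝ, E) 𝓘(ℝ, ℂ) ∞ fun x => (inner ℂ (s x) (t x) : ℂ)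

variable [VectorBundle ℂ ℂ L]

/-- `nabla` is a (smooth) Hermitian connection of the complex line bundle `L` whose Hermitian metric
is the inner product of the fibres: `nabla s x v` is `(∇_v s)(x)`, the Leibniz rule for real valued
functions is part of `CovariantDerivative`. -/
structure IsHermitianConnection [IsManifold 𝓘(ℝ, E) 1 X]
    (nabla : CovariantDerivative 𝓘(ℝ, E) ℂ L) : Prop where
  smooth : nabla.ContMDiffCovariantDerivative ∞
  map_I_smul : ∀ (s : (x : X) → L x) (x : X), DiffSectionAt E s x →
    ∀ v, nabla (fun y => Complex.I • s y) x v = Complex.I • nabla s x v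
  metric : ∀ (s t : (x : X) → L x) (x : X), DiffSectionAt E s x → DiffSectionAt E t x →
    ∀ v, mvfderiv 𝓘(ℝ, E) (fun y => inner ℂ (s y) (t y)) x v =
      inner ℂ (nabla s x v) (t x) + inner ℂ (s x) (nabla t x v)

/-- `R(U, V) s = ∇_U ∇_V s - ∇_V ∇_U s - ∇_{[U, V]} s` -/
def curvOp (nabla : CovariantDerivative 𝓘(ℝ, E) ℂ L) (s : (x : X) → L x)
    (U V : (x : X) → TangentSpace 𝓘(ℝ, E) x) (x : X) : L x :=
  nabla (fun y => nabla s y (V y)) x (U x) - nabla (fun y => nabla s y (U y)) x (V x)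
    - nabla s x (mlieBracket 𝓘(ℝ, E) U V x)

/-- `F` is the value at `x` of the curvature `2`-form of `nabla`: `R(U, V) s = F(U, V) s`. -/
def IsCurvatureAt [IsManifold 𝓘(ℝ, E) 1 X] (nabla : CovariantDerivative 𝓘(ℝ, E) ℂ L) (x : X)
    (F : TangentSpace 𝓘(ℝ, E) x [⋀^Fin 2]→ₗ[ℝ] ℂ) : Prop :=
  ∀ (s : (x : X) → L x) (U V : (x : X) → TangentSpace 𝓘(ℝ, E) x),
    SmoothSection E s → DiffFieldAt U x → DiffFieldAt V x →
      curvOp nabla s U V x = F ![U x, V x] • s x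

lemma exists_smooth_section [FiniteDimensional ℝ E] [T2Space X] [IsManifold 𝓘(ℝ, E) ∞ X]
    [ContMDiffVectorBundle ∞ ℂ L 𝓘(ℝ, E)] (x : X) (v : L x) :
    ∃ s : (x : X) → L x, SmoothSection E s ∧ ∀ᶠ y in nhds x, s y = FiberBundle.extend ℂ v y := by
  obtain ⟨u, hu, hs⟩ := FiberBundle.exists_contMDiffOn_extend (k := ∞) 𝓘(ℝ, E) ℂ v
  obtain ⟨w, hwu, hw, hxw⟩ := mem_nhds_iff.1 hu
  obtain ⟨f, hfw, -⟩ := (SmoothBumpFunction.nhds_basis_support (I := 𝓘(ℝ, E))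
    (hw.mem_nhds hxw)).mem_iff.1 (hw.mem_nhds hxw)
  refine ⟨fun y => f y • FiberBundle.extend ℂ v y, ?_, ?_⟩
  · exact ContMDiffOn.smul_section_of_tsupport f.contMDiff.contMDiffOn hw hfw (hs.mono hwu)
  · filter_upwards [f.eventuallyEq_one] with y hy
    simp [hy]


section

variable [IsManifold 𝓘(ℝ, E) ∞ X] [ContMDiffVectorBundle ∞ ℂ L 𝓘(ℝ, E)]
  {nabla : CovariantDerivative 𝓘(ℝ, E) ℂ L} {x : X} {U V : (x : X) → TangentSpace 𝓘(ℝ, E) x}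
  {s t : (x : X) → L x}

lemma SmoothSection.diffAt (hs : SmoothSection E s) (x : X) : DiffSectionAt E s x :=
  hs.mdifferentiableAt (by simp)

lemma IsHermitianConnection.diffAt (h : IsHermitianConnection nabla) (hs : SmoothSection E s)
    (hV : DiffFieldAt V x) : DiffSectionAt E (fun y => nabla s y (V y)) x := by
  have h1 := h.smooth.contMDiff.contMDiff (σ := s) (by simpa using hs.contMDiffOn)
  have h2 := (h1.contMDiffAt (x := x) Filter.univ_mem).mdifferentiableAt (by simp)
  exact MDifferentiableAt.clm_bundle_apply h2 hV

variable [FiniteDimensional ℝ E]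

lemma curvOp_tensorial_left (h : IsHermitianConnection nabla) (hs : SmoothSection E s)
    (_ : DiffFieldAt V x) : TensorialAt 𝓘(ℝ, E) E (fun U => curvOp nabla s U V x) x where
  smul {f U} hf hU := by
    have h1 := nabla.isCovariantDerivativeOnUniv.leibniz (h.diffAt hs hU) hf
    have h2 := mlieBracket_smul_left (W := V) hf hU
    have h3 : (fun y => nabla s y ((f • U) y)) = f • fun y => nabla s y (U y) := by
      ext y; simp
    simp only [curvOp]
    rw [h3, h1, h2]
    simp
    module
  add {U U'} hU hU' := by
    have h1 := nabla.isCovariantDerivativeOnUniv.add (h.diffAt hs hU) (h.diffAt hs hU')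
    have h2 := mlieBracket_add_left (W := V) hU hU'
    have h3 : (fun y => nabla s y ((U + U') y)) =
        (fun y => nabla s y (U y)) + fun y => nabla s y (U' y) := by
      ext y; simp
    simp only [curvOp]
    rw [h3, h1, h2]
    simp
    abel

lemma curvOp_swap : curvOp nabla s U V x = - curvOp nabla s V U x := by
  simp only [curvOp]
  rw [mlieBracket_swap_apply]
  simp
  abel

lemma curvOp_tensorial_right (h : IsHermitianConnection nabla) (hs : SmoothSection E s)
    (hU : DiffFieldAt U x) : TensorialAt 𝓘(ℝ, E) E (fun V => curvOp nabla s U V x) x where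
  smul {f V} hf hV := by
    have := (curvOp_tensorial_left h hs hU).smul hf hV
    rw [curvOp_swap, this, curvOp_swap (U := U)]
    simp
  add {V V'} hV hV' := by
    have := (curvOp_tensorial_left h hs hU).add hV hV'
    rw [curvOp_swap, this, curvOp_swap (U := U), curvOp_swap (U := U)]
    abel


lemma SmoothSection.add (hs : SmoothSection E s) (ht : SmoothSection E t) :
    SmoothSection E (s + t) :=
  ContMDiff.add_section hs ht

lemma SmoothSection.smul {f : X → ℝ} (hf : ContMDiff 𝓘(ℝ, E) 𝓘(ℝ, ℝ) ∞ f)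
    (hs : SmoothSection E s) : SmoothSection E (f • s) :=
  ContMDiff.smul_section hf hs

lemma curvOp_congr (h : IsHermitianConnection nabla) (hs : SmoothSection E s)
    (ht : SmoothSection E t) (hst : ∀ᶠ y in nhds x, s y = t y) (hU : DiffFieldAt U x)
    (hV : DiffFieldAt V x) : curvOp nabla s U V x = curvOp nabla t U V x := by
  have h1 : ∀ᶠ y in nhds x, nabla s y = nabla t y := by
    filter_upwards [hst.eventually_nhds] with y hy
    exact nabla.isCovariantDerivativeOnUniv.congr_of_eventuallyEq (hs.diffAt y) (ht.diffAt y)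
      Filter.univ_mem hy
  have h2 {W : (x : X) → TangentSpace 𝓘(ℝ, E) x} (hW : DiffFieldAt W x) :
      nabla (fun y => nabla s y (W y)) x = nabla (fun y => nabla t y (W y)) x :=
    nabla.isCovariantDerivativeOnUniv.congr_of_eventuallyEq (h.diffAt hs hW) (h.diffAt ht hW)
      Filter.univ_mem (by filter_upwards [h1] with y hy; rw [hy])
  rw [curvOp, curvOp, h2 hU, h2 hV, h1.self_of_nhds]

lemma curvOp_add (h : IsHermitianConnection nabla) (hs : SmoothSection E s)
    (ht : SmoothSection E t) (hU : DiffFieldAt U x) (hV : DiffFieldAt V x) :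
    curvOp nabla (s + t) U V x = curvOp nabla s U V x + curvOp nabla t U V x := by
  have h1 (y : X) : nabla (s + t) y = nabla s y + nabla t y :=
    nabla.isCovariantDerivativeOnUniv.add (hs.diffAt y) (ht.diffAt y)
  have h2 {W : (x : X) → TangentSpace 𝓘(ℝ, E) x} (hW : DiffFieldAt W x) :
      nabla (fun y => nabla (s + t) y (W y)) x =
        nabla (fun y => nabla s y (W y)) x + nabla (fun y => nabla t y (W y)) x := by
    rw [← nabla.isCovariantDerivativeOnUniv.add (h.diffAt hs hW) (h.diffAt ht hW)]
    congr 1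
    ext y
    simp [h1]
  rw [curvOp, curvOp, curvOp, h2 hU, h2 hV, h1]
  simp
  abel

lemma SmoothSection.I_smul (hs : SmoothSection E s) :
    SmoothSection E (fun y => Complex.I • s y) := by
  intro y
  have h := (contMDiffAt_section y).1 (hs y)
  rw [contMDiffAt_section]
  have h1 : ContMDiffAt 𝓘(ℝ, E) 𝓘(ℝ, ℂ) ∞
      (fun z => Complex.I • (trivializationAt ℂ L y ⟨z, s z⟩).2) y :=
    (ContinuousLinearMap.mul ℝ ℂ Complex.I).contMDiff.contMDiffAt.comp y h
  refine h1.congr_of_eventuallyEq ?_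
  filter_upwards [(trivializationAt ℂ L y).open_baseSet.mem_nhds
    (mem_baseSet_trivializationAt ℂ L y)] with z hz
  exact ((trivializationAt ℂ L y).linear ℂ hz).map_smul Complex.I (s z)

lemma curvOp_I_smul (h : IsHermitianConnection nabla) (hs : SmoothSection E s)
    (hU : DiffFieldAt U x) (hV : DiffFieldAt V x) :
    curvOp nabla (fun y => Complex.I • s y) U V x = Complex.I • curvOp nabla s U V x := by
  have h1 (y : X) (v) : nabla (fun y => Complex.I • s y) y v = Complex.I • nabla s y v :=
    h.map_I_smul s y (hs.diffAt y) v
  rw [curvOp, curvOp]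
  simp only [h1]
  rw [h.map_I_smul _ x (h.diffAt hs hU), h.map_I_smul _ x (h.diffAt hs hV), smul_sub, smul_sub]

lemma curvOp_smul (h : IsHermitianConnection nabla) {f : X → ℝ}
    (hf : ContMDiff 𝓘(ℝ, E) 𝓘(ℝ, ℝ) ∞ f) (hs : SmoothSection E s)
    (hU : DiffFieldAt U x) (hV : DiffFieldAt V x) :
    curvOp nabla (f • s) U V x = f x • curvOp nabla s U V x := by
  have hfd (y : X) : MDifferentiableAt 𝓘(ℝ, E) 𝓘(ℝ, ℝ) f y := hf.mdifferentiableAt (by simp)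
  have h1 (y : X) : nabla (f • s) y = f y • nabla s y + (mvfderiv 𝓘(ℝ, E) f y).smulRight (s y) :=
    nabla.isCovariantDerivativeOnUniv.leibniz (hs.diffAt y) (hfd y)
  have : CompleteSpace E := FiniteDimensional.complete ℝ E
  have h2 {W : (x : X) → TangentSpace 𝓘(ℝ, E) x} (hW : DiffFieldAt W x) :
      nabla (fun y => nabla (f • s) y (W y)) x =
        f x • nabla (fun y => nabla s y (W y)) x +
        (mvfderiv 𝓘(ℝ, E) f x).smulRight (nabla s x (W x)) +
        (mvfderiv 𝓘(ℝ, E) f x (W x) • nabla s x +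
        (mvfderiv 𝓘(ℝ, E) (fun y => mvfderiv 𝓘(ℝ, E) f y (W y)) x).smulRight (s x)) := by
    have hd := (lie_deriv_aux hf.contMDiffAt hW hW).1
    have e1 := nabla.isCovariantDerivativeOnUniv.leibniz (h.diffAt hs hW) (hfd x)
    have e2 := nabla.isCovariantDerivativeOnUniv.leibniz (hs.diffAt x) hd
    rw [← e1, ← e2, ← nabla.isCovariantDerivativeOnUniv.add
      ((hfd x).smul_section (h.diffAt hs hW)) (hd.smul_section (hs.diffAt x))]
    congr 1
    ext y
    simp [h1]
  rw [curvOp, curvOp, h2 hU, h2 hV, h1]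
  simp only [add_apply, smul_apply,
    ContinuousLinearMap.smulRight_apply, (lie_deriv_aux hf.contMDiffAt hU hV).2]
  module


lemma exists_smooth_function [T2Space X] {f : X → ℝ} {x : X}
    {w : Set X} (hw : IsOpen w) (hxw : x ∈ w) (hf : ContMDiffOn 𝓘(ℝ, E) 𝓘(ℝ, ℝ) ∞ f w) :
    ∃ g : X → ℝ, ContMDiff 𝓘(ℝ, E) 𝓘(ℝ, ℝ) ∞ g ∧ ∀ᶠ y in nhds x, g y = f y := by
  obtain ⟨φ, hφ, -⟩ := (SmoothBumpFunction.nhds_basis_support (I := 𝓘(ℝ, E))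
    (hw.mem_nhds hxw)).mem_iff.1 (hw.mem_nhds hxw)
  refine ⟨fun y => φ y • f y, contMDiff_of_tsupport fun y hy => ?_, ?_⟩
  · have hyw : y ∈ w := hφ (closure_mono (Function.support_smul_subset_left _ _) hy)
    exact φ.contMDiff.contMDiffAt.smul ((hf y hyw).contMDiffAt (hw.mem_nhds hyw))
  · filter_upwards [φ.eventuallyEq_one] with y hy
    simp [hy]

/-- Near a point, the sections of a line bundle are the multiples of a single one. -/
lemma exists_frame [T2Space X] (x : X) :
    ∃ s₀ : (x : X) → L x, SmoothSection E s₀ ∧ s₀ x ≠ 0 ∧ ∀ s, SmoothSection E s →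
      ∃ u v : X → ℝ, ContMDiff 𝓘(ℝ, E) 𝓘(ℝ, ℝ) ∞ u ∧ ContMDiff 𝓘(ℝ, E) 𝓘(ℝ, ℝ) ∞ v ∧
        ∀ᶠ y in nhds x, s y = (u • s₀ + v • fun y => Complex.I • s₀ y) y := by
  set e := trivializationAt ℂ L x with he
  have hx : x ∈ e.baseSet := mem_baseSet_trivializationAt ℂ L x
  obtain ⟨s₀, hs₀, h₀⟩ := exists_smooth_section (E := E) x (e.symm x 1)
  have hev : ∀ᶠ y in nhds x, y ∈ e.baseSet ∧ (e ⟨y, s₀ y⟩).2 = 1 := by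
    filter_upwards [e.open_baseSet.mem_nhds hx, h₀] with y hy hy0
    refine ⟨hy, ?_⟩
    rw [hy0]
    simp [FiberBundle.extend, ← he, hy, hx]
  refine ⟨s₀, hs₀, fun h => ?_, fun s hs => ?_⟩
  · have h1 := hev.self_of_nhds.2
    rw [h] at h1
    have h2 : (e ⟨x, (0 : L x)⟩).2 = 0 := (e.linear ℂ hx).map_zero
    rw [h2] at h1
    exact zero_ne_one h1
  · have hg : ContMDiffOn 𝓘(ℝ, E) 𝓘(ℝ, ℂ) ∞ (fun y => (e ⟨y, s y⟩).2) e.baseSet :=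
      (e.contMDiffOn_section_baseSet_iff (IB := 𝓘(ℝ, E)) (n := ∞)).1 hs.contMDiffOn
    have hre : ContMDiffOn 𝓘(ℝ, E) 𝓘(ℝ, ℝ) ∞ (fun y => Complex.reCLM (e ⟨y, s y⟩).2) e.baseSet :=
      Complex.reCLM.contMDiff.comp_contMDiffOn hg
    have him : ContMDiffOn 𝓘(ℝ, E) 𝓘(ℝ, ℝ) ∞ (fun y => Complex.imCLM (e ⟨y, s y⟩).2) e.baseSet :=
      Complex.imCLM.contMDiff.comp_contMDiffOn hg
    obtain ⟨u, hu, hu'⟩ := exists_smooth_function e.open_baseSet hx hre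
    obtain ⟨v, hv, hv'⟩ := exists_smooth_function e.open_baseSet hx him
    refine ⟨u, v, hu, hv, ?_⟩
    filter_upwards [hev, hu', hv'] with y hy hyu hyv
    apply (e.linearEquivAt ℂ y hy.1).injective
    have hlin : ∀ z : L y, e.linearEquivAt ℂ y hy.1 z = (e ⟨y, z⟩).2 := fun _ => rfl
    have hr (r : ℝ) (z : L y) : r • z = (r : ℂ) • z := (Complex.coe_smul r z).symm
    show _ = e.linearEquivAt ℂ y hy.1 (u y • s₀ y + v y • Complex.I • s₀ y)
    rw [hr, hr, map_add, map_smul, map_smul, map_smul, hlin, hlin, hy.2, hyu, hyv]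
    simp

/-- A Hermitian connection has a well defined curvature at every point. -/
lemma existsUnique_curvature [T2Space X] (h : IsHermitianConnection nabla) (x : X) :
    ∃! F, IsCurvatureAt nabla x F := by
  obtain ⟨s₀, hs₀, hne, hframe⟩ := exists_frame (E := E) (L := L) x
  let B := TensorialAt.mkHom₂ (I := 𝓘(ℝ, E)) (F := E) (F' := E)
    (fun U V => curvOp nabla s₀ U V x) x
    (fun V hV => curvOp_tensorial_left h hs₀ hV) (fun U hU => curvOp_tensorial_right h hs₀ hU)
  have hB {U V : (x : X) → TangentSpace 𝓘(ℝ, E) x} (hU : DiffFieldAt U x)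
      (hV : DiffFieldAt V x) : B (U x) (V x) = curvOp nabla s₀ U V x :=
    TensorialAt.mkHom₂_apply _ _ hU hV
  have hext (u : TangentSpace 𝓘(ℝ, E) x) :
      DiffFieldAt (FiberBundle.extend E u) x ∧ FiberBundle.extend E u x = u :=
    ⟨FiberBundle.mdifferentiableAt_extend 𝓘(ℝ, E) E u, FiberBundle.extend_apply_self E u⟩
  let ℓ := (trivializationAt ℂ L x).linearEquivAt ℂ x (mem_baseSet_trivializationAt ℂ L x)
  have hℓ : ℓ (s₀ x) ≠ 0 := fun h0 => hne (ℓ.map_eq_zero_iff.1 h0)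
  have hdiv (z : L x) : (ℓ z / ℓ (s₀ x)) • s₀ x = z := by
    apply ℓ.injective
    rw [map_smul, smul_eq_mul, div_mul_cancel₀ _ hℓ]
  have hr (r : ℝ) (z : L x) : ℓ (r • z) = r • ℓ z := by
    rw [← Complex.coe_smul, map_smul, Complex.coe_smul]
  let Φ : TangentSpace 𝓘(ℝ, E) x →ₗ[ℝ] TangentSpace 𝓘(ℝ, E) x →ₗ[ℝ] ℂ :=
    LinearMap.mk₂ ℝ (fun u v => ℓ (B u v) / ℓ (s₀ x))
      (fun u u' v => by rw [map_add, add_apply, map_add, add_div])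
      (fun c u v => by rw [map_smul, smul_apply, hr, smul_div_assoc])
      (fun u v v' => by rw [map_add, map_add, add_div])
      (fun c u v => by rw [map_smul, hr, smul_div_assoc])
  have hΦ (u : TangentSpace 𝓘(ℝ, E) x) : Φ u u = 0 := by
    have h1 := hB (hext u).1 (hext u).1
    rw [(hext u).2] at h1
    have h2 : B u u = 0 := by
      have h3 := curvOp_swap (nabla := nabla) (s := s₀) (x := x)
        (U := FiberBundle.extend E u) (V := FiberBundle.extend E u)
      rw [← h1] at h3
      have h4 : (2 : ℝ) • B u u = 0 := by rw [two_smul]; nth_rewrite 1 [h3]; simp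
      exact (smul_eq_zero.1 h4).resolve_left two_ne_zero
    show ℓ (B u u) / ℓ (s₀ x) = 0
    rw [h2, map_zero, zero_div]
  refine ⟨altOfBilin Φ hΦ, fun s U V hs hU hV => ?_, fun F' hF' => ?_⟩
  · obtain ⟨a, b, ha, hb, hev⟩ := hframe s hs
    have hIs := hs₀.I_smul
    have h0 : curvOp nabla s₀ U V x = Φ (U x) (V x) • s₀ x := by
      rw [← hB hU hV]
      exact (hdiv _).symm
    rw [curvOp_congr h hs ((hs₀.smul ha).add (hIs.smul hb)) hev hU hV,
      curvOp_add h (hs₀.smul ha) (hIs.smul hb) hU hV, curvOp_smul h ha hs₀ hU hV,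
      curvOp_smul h hb hIs hU hV, curvOp_I_smul h hs₀ hU hV, h0, hev.self_of_nhds]
    show _ = Φ (U x) (V x) • (a x • s₀ x + b x • Complex.I • s₀ x)
    simp only [smul_add, ← Complex.coe_smul (_ : ℝ) (_ : L x), smul_smul]
    congr 2 <;> ring
  · ext w
    have hw : w = ![w 0, w 1] := by
      ext i; fin_cases i <;> rfl
    have h1 := hF' s₀ _ _ hs₀ (hext (w 0)).1 (hext (w 1)).1
    rw [← hB (hext (w 0)).1 (hext (w 1)).1, (hext (w 0)).2, (hext (w 1)).2, ← hw,
      ← hdiv (B (w 0) (w 1))] at h1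
    exact (smul_left_injective ℂ hne h1).symm

/-- The curvature `2`-form of a Hermitian connection (with values in `iℝ ⊆ ℂ`). -/
def IsHermitianConnection.curvature [T2Space X] (h : IsHermitianConnection nabla) (x : X) :
    TangentSpace 𝓘(ℝ, E) x [⋀^Fin 2]→ₗ[ℝ] ℂ :=
  (existsUnique_curvature h x).choose

lemma IsHermitianConnection.isCurvatureAt [T2Space X] (h : IsHermitianConnection nabla) (x : X) :
    IsCurvatureAt nabla x (h.curvature x) :=
  (existsUnique_curvature h x).choose_spec.1

end

end LineBundle
end Connection

/-! ## Kähler manifolds -/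

section Geometry

open VectorField Bundle

variable {E : Type*} [NormedAddCommGroup E] [NormedSpace ℂ E]
  {X : Type*} [TopologicalSpace X] [ChartedSpace E X]

/-- A complex manifold is in particular a real smooth manifold. -/
instance realManifold [IsManifold 𝓘(ℂ, E) ∞ X] : IsManifold 𝓘(ℝ, E) ∞ X := by
  refine isManifold_of_contDiffOn _ _ _ fun e e' he he' => ?_
  have h := (contDiffGroupoid ∞ 𝓘(ℂ, E)).compatible he he'
  rw [contDiffGroupoid, mem_groupoid_of_pregroupoid] at h
  exact h.1.restrict_scalars ℝ

/-- The complex structure `J` of the tangent spaces of a complex manifold: multiplication by `i`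
in a holomorphic chart. -/
def complexStr (E : Type*) [NormedAddCommGroup E] [NormedSpace ℂ E]
    {X : Type*} [TopologicalSpace X] [ChartedSpace E X] (x : X) :
    TangentSpace 𝓘(ℝ, E) x →ₗ[ℝ] TangentSpace 𝓘(ℝ, E) x :=
  show E →ₗ[ℝ] E from
    { toFun := fun v => Complex.I • v
      map_add' := smul_add _
      map_smul' := fun _ _ => smul_comm _ _ _ }

lemma complexStr_sq (x : X) (u : TangentSpace 𝓘(ℝ, E) x) :
    complexStr E x (complexStr E x u) = -u := by
  have h : Complex.I • (Complex.I • (show E from u)) = -(show E from u) := by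
    rw [smul_smul, Complex.I_mul_I, neg_one_smul]
  exact h

instance [FiniteDimensional ℂ E] (x : X) : FiniteDimensional ℝ (TangentSpace 𝓘(ℝ, E) x) :=
  inferInstanceAs (FiniteDimensional ℝ E)

variable (E) in
/-- The function `x ↦ ω(A, B)(x)` of two vector fields, for the fundamental form
`ω(u, v) = g(Ju, v)` of a Riemannian metric `g`. -/
def fundamentalForm [RiemannianBundle (fun x : X => TangentSpace 𝓘(ℝ, E) x)]
    (A B : (x : X) → TangentSpace 𝓘(ℝ, E) x) (x : X) : ℝ :=
  inner ℝ (complexStr E x (A x)) (B x)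

/-- The Riemannian metric `g` of the complex manifold `X` is a Kähler metric: `J` is orthogonal and
the fundamental form `ω` is closed, the latter through the invariant formula for the exterior
derivative `dω(U, V, W)` on smooth vector fields. -/
structure IsKahler (E : Type*) [NormedAddCommGroup E] [NormedSpace ℂ E]
    (X : Type*) [TopologicalSpace X] [ChartedSpace E X]
    [IsManifold 𝓘(ℂ, E) ∞ X] [RiemannianBundle (fun x : X => TangentSpace 𝓘(ℝ, E) x)] :
    Prop where
  inner_complexStr : ∀ (x : X) (u v : TangentSpace 𝓘(ℝ, E) x),
    inner ℝ (complexStr E x u) (complexStr E x v) = inner ℝ u v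
  closed : ∀ U V W : (x : X) → TangentSpace 𝓘(ℝ, E) x,
    SmoothField U → SmoothField V → SmoothField W → ∀ x,
      mvfderiv 𝓘(ℝ, E) (fundamentalForm E V W) x (U x)
        - mvfderiv 𝓘(ℝ, E) (fundamentalForm E U W) x (V x)
        + mvfderiv 𝓘(ℝ, E) (fundamentalForm E U V) x (W x)
        - fundamentalForm E (mlieBracket 𝓘(ℝ, E) U V) W x
        + fundamentalForm E (mlieBracket 𝓘(ℝ, E) U W) V x
        - fundamentalForm E (mlieBracket 𝓘(ℝ, E) V W) U x = 0

section Kahler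

variable [IsManifold 𝓘(ℂ, E) ∞ X] [RiemannianBundle (fun x : X => TangentSpace 𝓘(ℝ, E) x)]

/-- The Kähler form `ω(u, v) = g(Ju, v)`. -/
def IsKahler.form (hK : IsKahler E X) (x : X) : CForm (TangentSpace 𝓘(ℝ, E) x) 2 :=
  altOfBilin
    (LinearMap.mk₂ ℝ (fun u v => ((inner ℝ (complexStr E x u) v : ℝ) : ℂ))
      (fun u u' v => by simp [inner_add_left])
      (fun c u v => by simp [real_inner_smul_left])
      (fun u v v' => by simp [inner_add_right])
      (fun c u v => by simp [real_inner_smul_right]))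
    (fun u => by
      have h := hK.inner_complexStr x u (complexStr E x u)
      rw [complexStr_sq, inner_neg_right, real_inner_comm u] at h
      have h' : (inner ℝ (complexStr E x u) u : ℝ) = 0 := by
        rw [real_inner_comm]
        linarith
      rw [LinearMap.mk₂_apply, h', Complex.ofReal_zero])

lemma IsKahler.form_apply (hK : IsKahler E X) (x : X) (u v : TangentSpace 𝓘(ℝ, E) x) :
    hK.form x ![u, v] = ((inner ℝ (complexStr E x u) v : ℝ) : ℂ) :=
  rfl

variable [FiniteDimensional ℂ E] [T2Space X]
  {L : X → Type*} [TopologicalSpace (TotalSpace ℂ L)] [∀ x, NormedAddCommGroup (L x)]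
  [∀ x, InnerProductSpace ℂ (L x)] [FiberBundle ℂ L] [VectorBundle ℂ ℂ L]
  [ContMDiffVectorBundle ∞ ℂ L 𝓘(ℝ, E)] {nabla : CovariantDerivative 𝓘(ℝ, E) ℂ L}

/-- The curvature of a Hermitian connection, on the Euclidean vector space `T_x X`. -/
def IsHermitianConnection.curvatureForm (h : IsHermitianConnection nabla) (x : X) :
    CForm (TangentSpace 𝓘(ℝ, E) x) 2 :=
  h.curvature x

/-- The power `(ω + F)ʳ` of the sum of the Kähler form and of the curvature form. -/
def totalPow (hK : IsKahler E X) (h : IsHermitianConnection nabla) (r : ℕ) (x : X) :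
    CForm (TangentSpace 𝓘(ℝ, E) x) (2 * r) :=
  CForm.pow (hK.form x + h.curvatureForm x) r

/-- The Hermitian connection `nabla` on a Kähler manifold of dimension `n` is deformed
Hermitian-Yang-Mills (dHYM) with phase `e^{iθ}`: `π^{[[2,0]]}(-iF) = 0` and
`Im (e^{-iθ} (ω + F)ⁿ) = 0`. -/
def IsDHYM (hK : IsKahler E X) (h : IsHermitianConnection nabla) (θ : ℝ) : Prop :=
  ∀ x : X, CForm.bracketProj (complexStr E x) 2 0 (-Complex.I • h.curvatureForm x) = 0 ∧
    CForm.im (Complex.exp (-(θ * Complex.I)) • totalPow hK h (finrank ℂ E) x) = 0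

end Kahler

end Geometry

end

/-! Both claims concern a single tangent space `V`, of real dimension 8. There `K` = (-iF)^♯ is a
skew operator, and F takes imaginary values by `IsHermitianConnection.curvature_re`. Split `K` into
a part commuting with `J` and a part anticommuting with it. The first is -JS with S symmetric and
commuting with `J`, so `exists_unitary_eigenframe` diagonalises it in a unitary frame. In the
coordinates (z, z̄)/√2 this reads dz_j ∘ K = i s_j dz_j + Σ n_jk dz̄_k with s real and n
skew-symmetric (`exists_unitary_coordinates`); n carries the (0,2)-part of F. With p_j = 1 + i s_j
and q = p̄ = 2 - p, the operator id + K has blocks p, n, n̄, q, while ω + F has matrix i ·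
`blockSkew p n n̄`.

The components of (ω + F)^r / r! are, up to the factor i^r, the Pfaffians of the principal
submatrices of size 2r. The coordinates are unitary and adapted to `J`, so each norm in part 1 is
the sum of |Pf|² over the increasing multi-indices of the prescribed types. Part 1 thus becomes the
algebraic identity `det_fromBlocks_skewFour`. The weights 2 and 8 are visible when only a = n_01 and
f = n_23 survive above the diagonal. The determinant is then (X + 4|a|²)(Y + 4|f|²), where X = |p_0
p_1 - |a|²|² and Y is its analogue for the indices 2, 3. Here XY is the square of the top Pfaffian.
The terms 4|a|²Y and 4|f|²X are twice the squares of types (4,2) and (2,4), each square occurring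
once in either type. Finally 16|a|²|f|² is eight times the two squares |af|² of types (4,0) and
(0,4). The general case is a computation with a Schur complement.

For part 2, the phase has modulus one, so part 1 writes det(id + K) as the square of the real part
plus the square of the imaginary part plus the two weighted squares. This gives the inequality, with
equality exactly when the last three vanish. The two projections vanish if and only if n = 0, that
is F has no (2,0)- and (0,2)-part: Pf(n) = 0 reduces the Pfaffians of type (2,4) to ±p_j p_k n_lm,
and p_j ≠ 0 because its real part is 1 (`skewFour_eq_zero`). -/

noncomputable section

/-! ### Unitary diagonalisation of complex linear symmetric operators -/

section UnitaryFrame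

variable {V : Type*} [NormedAddCommGroup V] [InnerProductSpace ℝ V] [FiniteDimensional ℝ V]

/-- A symmetric operator commuting with an orthogonal complex structure is diagonal in a unitary
frame. -/
lemma exists_unitary_eigenframe {J S : V →ₗ[ℝ] V} (hJ2 : ∀ v, J (J v) = -v)
    (hJ : ∀ u v, inner ℝ (J u) (J v) = inner ℝ u v) (hS : S.IsSymmetric)
    (hSJ : ∀ v, S (J v) = J (S v)) {n : ℕ} (hn : finrank ℝ V = 2 * n) (k : ℕ) (hk : k ≤ n) :
    ∃ (e : Fin k → V) (a : Fin k → ℝ), (∀ i j, inner ℝ (e i) (e j) = if i = j then (1 : ℝ) else 0) ∧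
      (∀ i j, inner ℝ (e i) (J (e j)) = (0 : ℝ)) ∧ ∀ i, S (e i) = a i • e i := by
  have hskew (u v : V) : inner ℝ (J u) v = -(inner ℝ u (J v) : ℝ) := by
    have := hJ u (J v)
    rw [hJ2, inner_neg_right] at this
    linarith
  have hself (u : V) : inner ℝ u (J u) = (0 : ℝ) := by
    have := hskew u u
    rw [real_inner_comm] at this
    linarith
  induction k with
  | zero => exact ⟨Fin.elim0, Fin.elim0, fun i => i.elim0, fun i => i.elim0, fun i => i.elim0⟩
  | succ k ih =>
    obtain ⟨e, a, he, heJ, hSe⟩ := ih (by omega)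
    let b : Fin k ⊕ Fin k → V := Sum.elim e fun i => J (e i)
    let U : Submodule ℝ V := Submodule.span ℝ (Set.range b)
    have hmem (v : V) :
        v ∈ Uᗮ ↔ ∀ i, inner ℝ (e i) v = (0 : ℝ) ∧ inner ℝ (J (e i)) v = (0 : ℝ) := by
      constructor
      · intro hv i
        exact ⟨hv _ (Submodule.subset_span ⟨Sum.inl i, rfl⟩),
          hv _ (Submodule.subset_span ⟨Sum.inr i, rfl⟩)⟩
      · intro hv
        rw [Submodule.mem_orthogonal]
        intro u hu
        induction hu using Submodule.span_induction with
        | mem x hx =>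
          obtain ⟨i | i, rfl⟩ := hx
          · exact (hv i).1
          · exact (hv i).2
        | zero => simp
        | add x y _ _ hx hy => rw [inner_add_left, hx, hy, add_zero]
        | smul c x _ hx => rw [real_inner_smul_left, hx, mul_zero]
    have hUS : ∀ v ∈ Uᗮ, S v ∈ Uᗮ := by
      intro v hv
      rw [hmem] at hv ⊢
      intro i
      rw [← hS, ← hS, hSJ, hSe, map_smul, real_inner_smul_left, real_inner_smul_left,
        (hv i).1, (hv i).2]
      simp
    have hdim : finrank ℝ U ≤ k + k := by
      have := finrank_range_le_card (R := ℝ) b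
      simpa [Set.finrank] using this
    have hdim2 := U.finrank_add_finrank_orthogonal
    -- The span of the e_i and J e_i has dimension at most 2k < 2n, so its `S`-invariant complement
    -- is nonzero and supplies the next eigenvector.
    have : Nontrivial Uᗮ := Module.nontrivial_of_finrank_pos (R := ℝ) (by omega)
    have hsym : (S.restrict hUS).IsSymmetric := hS.restrict_invariant hUS
    obtain ⟨μ, w, hw⟩ : ∃ μ : ℝ, ∃ w, End.HasEigenvector (S.restrict hUS) μ w :=
      ⟨_, hsym.hasEigenvalue_iSup_of_finiteDimensional.exists_hasEigenvector⟩
    have hw0 : (w : V) ≠ 0 := fun h => hw.2 (Subtype.ext h)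
    have hwS : S (w : V) = μ • (w : V) := congrArg Subtype.val hw.apply_eq_smul
    have hwU := (hmem w).1 w.2
    let x : V := (‖(w : V)‖⁻¹ : ℝ) • (w : V)
    have hxx : inner ℝ x x = (1 : ℝ) := by
      rw [real_inner_self_eq_norm_sq, norm_smul, norm_inv, norm_norm,
        inv_mul_cancel₀ (norm_ne_zero_iff.2 hw0), one_pow]
    have hxe (i : Fin k) : inner ℝ (e i) x = (0 : ℝ) := by
      rw [real_inner_smul_right, (hwU i).1, mul_zero]
    have hxJe (i : Fin k) : inner ℝ (J (e i)) x = (0 : ℝ) := by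
      rw [real_inner_smul_right, (hwU i).2, mul_zero]
    refine ⟨Fin.cons x e, Fin.cons μ a, ?_, ?_, ?_⟩
    · intro i j
      induction i using Fin.cases with
      | zero =>
        induction j using Fin.cases with
        | zero => simpa using hxx
        | succ j => simpa [(Fin.succ_ne_zero j).symm, real_inner_comm] using hxe j
      | succ i =>
        induction j using Fin.cases with
        | zero => simpa using hxe i
        | succ j => simpa using he i j
    · intro i j
      induction i using Fin.cases with
      | zero =>
        induction j using Fin.cases with
        | zero => simpa using hself x
        | succ j =>
          rw [real_inner_comm]
          simpa using hxJe j
      | succ i =>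
        induction j using Fin.cases with
        | zero =>
          have := hskew (e i) x
          rw [hxJe] at this
          simp only [Fin.cons_succ, Fin.cons_zero]
          linarith
        | succ j => simpa using heJ i j
    · intro i
      induction i using Fin.cases with
      | zero =>
        simp only [Fin.cons_zero]
        rw [map_smul, hwS, smul_comm]
      | succ i => simpa using hSe i

end UnitaryFrame

/-! ### Wedge products as sums over permutations -/

section Wedge

namespace AlternatingMap

variable {R M : Type*} [CommRing R] [Algebra R ℂ] [AddCommGroup M] [Module R M]

/-- The wedge product of complex valued alternating maps over a ring `R`; over `ℝ` it is
`CForm.wedge`. -/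
def cwedge {k l : ℕ} (α : M [⋀^Fin k]→ₗ[R] ℂ) (β : M [⋀^Fin l]→ₗ[R] ℂ) :
    M [⋀^Fin (k + l)]→ₗ[R] ℂ :=
  ((LinearMap.mul' R ℂ).compAlternatingMap (α.domCoprod β)).domDomCongr finSumFinEquiv

/-- The power `αʳ = α ∧ ⋯ ∧ α` of a `2`-form; over `ℝ` it is `CForm.pow`. -/
def cpow (α : M [⋀^Fin 2]→ₗ[R] ℂ) : (r : ℕ) → M [⋀^Fin (2 * r)]→ₗ[R] ℂ
  | 0 => AlternatingMap.constOfIsEmpty R M (Fin 0) (1 : ℂ)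
  | r + 1 => cwedge (cpow α r) α

/-- `domCoprod` sums over shuffles, the cosets of S_k × S_l; the full sum over permutations counts
each coset k! l! times. -/
lemma factorial_mul_cwedge_apply {k l : ℕ} (α : M [⋀^Fin k]→ₗ[R] ℂ) (β : M [⋀^Fin l]→ₗ[R] ℂ)
    (v : Fin (k + l) → M) :
    ((k.factorial * l.factorial : ℕ) : ℂ) * cwedge α β v =
      ∑ σ : Equiv.Perm (Fin k ⊕ Fin l), ((Equiv.Perm.sign σ : ℤ) : ℂ) *
        (α (fun i => v (finSumFinEquiv (σ (Sum.inl i)))) *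
          β fun j => v (finSumFinEquiv (σ (Sum.inr j)))) := by
  have h := congrArg (fun f => LinearMap.mul' R ℂ (f fun i => v (finSumFinEquiv i)))
    (MultilinearMap.domCoprod_alternization_eq α β)
  simp only [MultilinearMap.alternatization_apply, map_sum, Fintype.card_fin,
    AlternatingMap.smul_apply, map_nsmul] at h
  rw [nsmul_eq_mul] at h
  refine Eq.trans h.symm (Finset.sum_congr rfl fun σ _ => ?_)
  rw [Units.smul_def, map_zsmul, zsmul_eq_mul]
  rfl

/-- The equivalence which puts the last two indices in front. -/
def lastTwoFirst (k : ℕ) : Fin k ⊕ Fin 2 ≃ Fin (k + 2) :=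
  (Equiv.sumComm _ _).trans (finSumFinEquiv.trans (finCongr (add_comm 2 k)))

lemma lastTwoFirst_inl {k : ℕ} (i : Fin k) : lastTwoFirst k (Sum.inl i) = i.succ.succ := by
  ext; simp [lastTwoFirst]

lemma lastTwoFirst_inr_zero {k : ℕ} : lastTwoFirst k (Sum.inr 0) = 0 := by
  ext; simp [lastTwoFirst]

lemma lastTwoFirst_inr_one {k : ℕ} : lastTwoFirst k (Sum.inr 1) = 1 := by
  ext; simp [lastTwoFirst]

lemma sum_perm_succ {n : ℕ} {A : Type*} [AddCommMonoid A] (f : Equiv.Perm (Fin (n + 1)) → A) :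
    ∑ σ, f σ = ∑ p, ∑ e, f (Equiv.Perm.decomposeFin.symm (p, e)) := by
  rw [← Fintype.sum_prod_type', ← Equiv.sum_comp Equiv.Perm.decomposeFin.symm]

/-- With the arguments of `β` listed first, two applications of `decomposeFin` choose them as `p`
and `q`, at the cost of the signs of two transpositions. The remaining permutations only rearrange
the arguments of the alternating `α`, so all k! of them give the same term. What is left is the
factor 2! of `β`, which makes this a recursion for powers of a 2-form. -/
lemma two_mul_cwedge_apply {k : ℕ} (α : M [⋀^Fin k]→ₗ[R] ℂ) (β : M [⋀^Fin 2]→ₗ[R] ℂ)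
    (u : Fin (k + 2) → M) :
    2 * cwedge α β (fun i => u (lastTwoFirst k (finSumFinEquiv.symm i))) =
      ∑ p : Fin (k + 2), ∑ q : Fin (k + 1), (if p = 0 then 1 else -1) * (if q = 0 then 1 else -1) *
        β ![u p, u (Equiv.swap 0 p q.succ)] *
          α fun i => u (Equiv.swap 0 p (Equiv.swap 0 q i.succ).succ) := by
  have hk : (k.factorial : ℂ) ≠ 0 := by exact_mod_cast k.factorial_ne_zero
  apply mul_left_cancel₀ hk
  have h := factorial_mul_cwedge_apply α β
    (fun i => u (lastTwoFirst k (finSumFinEquiv.symm i)))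
  simp only [Equiv.symm_apply_apply] at h
  rw [← mul_assoc]
  refine Eq.trans (by push_cast [Nat.factorial_two]; rfl) (h.trans ?_)
  have hβ (w : Fin 2 → M) : w = ![w 0, w 1] := by
    ext i; fin_cases i <;> rfl
  rw [← Equiv.sum_comp (lastTwoFirst k).symm.permCongr, sum_perm_succ, Finset.mul_sum]
  refine Finset.sum_congr rfl fun p _ => ?_
  rw [sum_perm_succ, Finset.mul_sum]
  refine Finset.sum_congr rfl fun q _ => ?_
  have hcard (z : ℂ) : (k.factorial : ℂ) * z = ∑ _e : Equiv.Perm (Fin k), z := by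
    simp [Fintype.card_perm]
  rw [hcard]
  refine Finset.sum_congr rfl fun e _ => ?_
  rw [hβ fun j => u _]
  simp only [Equiv.permCongr_apply, Equiv.symm_symm, Equiv.apply_symm_apply, lastTwoFirst_inl,
    lastTwoFirst_inr_zero, lastTwoFirst_inr_one, Equiv.Perm.sign_permCongr,
    Equiv.Perm.decomposeFin.symm_sign, Equiv.Perm.decomposeFin_symm_apply_succ,
    Equiv.Perm.decomposeFin_symm_apply_zero]
  have h1 : (Equiv.Perm.decomposeFin.symm (p, Equiv.Perm.decomposeFin.symm (q, e)))
      (1 : Fin (k + 2)) = Equiv.swap 0 p q.succ := by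
    rw [← Fin.succ_zero_eq_one, Equiv.Perm.decomposeFin_symm_apply_succ,
      Equiv.Perm.decomposeFin_symm_apply_zero]
  have h2 := α.map_perm (fun i => u (Equiv.swap 0 p (Equiv.swap 0 q i.succ).succ)) e
  rw [Function.comp_def] at h2
  rw [h1, h2, Units.smul_def, zsmul_eq_mul]
  have h3 : ((Equiv.Perm.sign e : ℤ) : ℂ) * ((Equiv.Perm.sign e : ℤ) : ℂ) = 1 := by
    rw [← Int.cast_mul, ← Units.val_mul, Int.units_mul_self]; simp
  have h4 (P : Prop) [Decidable P] :
      (((if P then 1 else -1 : ℤˣ) : ℤ) : ℂ) = if P then 1 else -1 := by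
    split_ifs <;> simp
  rw [Units.val_mul, Units.val_mul, Int.cast_mul, Int.cast_mul, h4, h4]
  linear_combination ((if p = 0 then 1 else -1) * (if q = 0 then 1 else -1) *
    β ![u p, u (Equiv.swap 0 p q.succ)] *
      α fun i => u (Equiv.swap 0 p (Equiv.swap 0 q i.succ).succ)) * h3

variable (γ : M [⋀^Fin 2]→ₗ[R] ℂ)

lemma apply_vec_swap (a b : M) : γ ![a, b] = -γ ![b, a] := by
  have h := γ.map_swap ![b, a] (i := 0) (j := 1) (by decide)
  rw [← h]
  congr 1
  ext i; fin_cases i <;> rfl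

lemma cpow_one_apply (v : Fin 2 → M) : cpow γ 1 v = γ ![v 0, v 1] := by
  have h := two_mul_cwedge_apply (cpow γ 0) γ v
  have hv : (fun i => v (lastTwoFirst 0 (finSumFinEquiv.symm i))) = v := by
    ext i; fin_cases i <;> rfl
  rw [hv] at h
  have h0 (w : Fin 0 → M) : cpow γ 0 w = 1 := rfl
  simp [Fin.sum_univ_two, h0] at h
  rw [apply_vec_swap γ (v 1) (v 0)] at h
  have h' : 2 * cpow γ 1 v = _ := h
  linear_combination h' / 2

end AlternatingMap
end Wedge

/-! ### Powers of a 2-form as Pfaffians -/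

section Pfaffian

variable {ι : Type*}

/-- The Pfaffian of the `4 × 4` submatrix of `m` with the given indices. -/
def pfaffianFour (m : ι → ι → ℂ) (a b c d : ι) : ℂ :=
  m a b * m c d - m a c * m b d + m a d * m b c

/-- The Pfaffian of the `6 × 6` submatrix of `m` with the given indices. -/
def pfaffianSix (m : ι → ι → ℂ) (a b c d e f : ι) : ℂ :=
  m a b * pfaffianFour m c d e f - m a c * pfaffianFour m b d e f
    + m a d * pfaffianFour m b c e f - m a e * pfaffianFour m b c d f
    + m a f * pfaffianFour m b c d e

/-- The Pfaffian of the `8 × 8` submatrix of `m` with the given indices. -/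
def pfaffianEight (m : ι → ι → ℂ) (a b c d e f g h : ι) : ℂ :=
  m a b * pfaffianSix m c d e f g h - m a c * pfaffianSix m b d e f g h
    + m a d * pfaffianSix m b c e f g h - m a e * pfaffianSix m b c d f g h
    + m a f * pfaffianSix m b c d e g h - m a g * pfaffianSix m b c d e f h
    + m a h * pfaffianSix m b c d e f g

namespace AlternatingMap

variable {R M : Type*} [CommRing R] [Algebra R ℂ] [AddCommGroup M] [Module R M]
  (γ : M [⋀^Fin 2]→ₗ[R] ℂ)

lemma two_mul_cpow_succ (r : ℕ) (u : Fin (2 * r + 2) → M) :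
    2 * cpow γ (r + 1) (fun i => u (lastTwoFirst (2 * r) (finSumFinEquiv.symm i))) =
      ∑ p : Fin (2 * r + 2), ∑ q : Fin (2 * r + 1),
        (if p = 0 then 1 else -1) * (if q = 0 then 1 else -1) *
        γ ![u p, u (Equiv.swap 0 p q.succ)] *
          cpow γ r fun i => u (Equiv.swap 0 p (Equiv.swap 0 q i.succ).succ) :=
  two_mul_cwedge_apply _ _ _

lemma cpow_two_apply (v : Fin 4 → M) :
    cpow γ 2 v = 2 * pfaffianFour (fun a b => γ ![a, b]) (v 0) (v 1) (v 2) (v 3) := by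
  -- The rotation of `v` that the reindexing by `lastTwoFirst` undoes.
  let u : Fin 4 → M := ![v 2, v 3, v 0, v 1]
  have hv : (fun i => u (lastTwoFirst 2 (finSumFinEquiv.symm i))) = v := by
    ext i; fin_cases i <;> rfl
  have h : 2 * cpow γ 2 v = ∑ p : Fin 4, ∑ q : Fin 3,
        (if p = 0 then 1 else -1) * (if q = 0 then 1 else -1) *
        γ ![u p, u (Equiv.swap 0 p q.succ)] *
          cpow γ 1 fun i => u (Equiv.swap 0 p (Equiv.swap 0 q i.succ).succ) := by
    conv_lhs => rw [← hv]
    exact two_mul_cpow_succ γ 1 u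
  have hs (i j : Fin 4) : γ ![v i, v j] = -γ ![v j, v i] := apply_vec_swap γ _ _
  simp only [cpow_one_apply, Fin.sum_univ_four, Fin.sum_univ_three] at h
  simp [Equiv.swap_apply_def, u] at h
  -- Skew-symmetry puts every entry in increasing order of indices, after which both sides are
  -- polynomials in the same variables.
  simp only [hs 1 0, hs 2 0, hs 2 1, hs 3 0, hs 3 1, hs 3 2] at h
  unfold pfaffianFour
  linear_combination h / 2

set_option maxRecDepth 4000 in
lemma cpow_three_apply (v : Fin 6 → M) :
    cpow γ 3 v = 6 * pfaffianSix (fun a b => γ ![a, b]) (v 0) (v 1) (v 2) (v 3) (v 4) (v 5) := by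
  let u : Fin 6 → M := ![v 4, v 5, v 0, v 1, v 2, v 3]
  have hv : (fun i => u (lastTwoFirst 4 (finSumFinEquiv.symm i))) = v := by
    ext i; fin_cases i <;> rfl
  have h : 2 * cpow γ 3 v = ∑ p : Fin 6, ∑ q : Fin 5,
        (if p = 0 then 1 else -1) * (if q = 0 then 1 else -1) *
        γ ![u p, u (Equiv.swap 0 p q.succ)] *
          cpow γ 2 fun i => u (Equiv.swap 0 p (Equiv.swap 0 q i.succ).succ) := by
    conv_lhs => rw [← hv]
    exact two_mul_cpow_succ γ 2 u
  have hs (i j : Fin 6) : γ ![v i, v j] = -γ ![v j, v i] := apply_vec_swap γ _ _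
  simp only [cpow_two_apply, Fin.sum_univ_six, Fin.sum_univ_five] at h
  simp [Equiv.swap_apply_def, u] at h
  unfold pfaffianFour at h
  simp only [hs 1 0, hs 2 0, hs 2 1, hs 3 0, hs 3 1, hs 3 2, hs 4 0, hs 4 1, hs 4 2, hs 4 3,
    hs 5 0, hs 5 1, hs 5 2, hs 5 3, hs 5 4] at h
  unfold pfaffianSix pfaffianFour
  linear_combination h / 2

omit [AddCommGroup M] in
lemma comp_lastTwoFirst_six (u : Fin 8 → M) :
    (fun i => u (lastTwoFirst (2 * 3) (finSumFinEquiv.symm i))) =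
      (![u 2, u 3, u 4, u 5, u 6, u 7, u 0, u 1] : Fin 8 → M) := by
  have h (w : Fin (6 + 2) → M) : (fun i => w (lastTwoFirst 6 (finSumFinEquiv.symm i))) =
      ![w 2, w 3, w 4, w 5, w 6, w 7, w 0, w 1] := by
    ext i; fin_cases i <;> rfl
  exact h u

-- The recursion is used in its own order of arguments, with the last two first; `cpow_four_apply`
-- rotates them back. The entries of the target Pfaffian that involve `u 0` or `u 1` are flipped to
-- match.
set_option maxRecDepth 8000 in
set_option maxHeartbeats 4000000 in
lemma cpow_four_apply_aux (u : Fin 8 → M) :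
    cpow γ 4 (![u 2, u 3, u 4, u 5, u 6, u 7, u 0, u 1] : Fin 8 → M) =
      24 * pfaffianEight (fun a b => γ ![a, b]) (u 2) (u 3) (u 4) (u 5) (u 6) (u 7) (u 0)
        (u 1) := by
  have h := two_mul_cpow_succ γ 3 u
  have hs (i j : Fin 8) : γ ![u i, u j] = -γ ![u j, u i] := apply_vec_swap γ _ _
  simp only [comp_lastTwoFirst_six] at h
  have h8 (f : Fin (2 * 3 + 2) → ℂ) : ∑ i, f i = f (0 : Fin 8) + f (1 : Fin 8) + f (2 : Fin 8) +
      f (3 : Fin 8) + f (4 : Fin 8) + f (5 : Fin 8) + f (6 : Fin 8) + f (7 : Fin 8) :=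
    Fin.sum_univ_eight f
  have h7 (f : Fin (2 * 3 + 1) → ℂ) : ∑ i, f i = f (0 : Fin 7) + f (1 : Fin 7) + f (2 : Fin 7) +
      f (3 : Fin 7) + f (4 : Fin 7) + f (5 : Fin 7) + f (6 : Fin 7) :=
    Fin.sum_univ_seven f
  simp only [h8, h7, cpow_three_apply] at h
  simp [Equiv.swap_apply_def] at h
  unfold pfaffianSix pfaffianFour at h
  simp only [hs 1 0, hs 2 0, hs 2 1, hs 3 0, hs 3 1, hs 3 2, hs 4 0, hs 4 1, hs 4 2, hs 4 3,
    hs 5 0, hs 5 1, hs 5 2, hs 5 3, hs 5 4, hs 6 0, hs 6 1, hs 6 2, hs 6 3, hs 6 4, hs 6 5,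
    hs 7 0, hs 7 1, hs 7 2, hs 7 3, hs 7 4, hs 7 5, hs 7 6] at h
  unfold pfaffianEight pfaffianSix pfaffianFour
  simp only [hs 2 0, hs 2 1, hs 3 0, hs 3 1, hs 4 0, hs 4 1, hs 5 0, hs 5 1, hs 6 0, hs 6 1, hs 7 0,
    hs 7 1]
  linear_combination h / 2

lemma cpow_four_apply (v : Fin 8 → M) :
    cpow γ 4 v = 24 * pfaffianEight (fun a b => γ ![a, b])
      (v 0) (v 1) (v 2) (v 3) (v 4) (v 5) (v 6) (v 7) := by
  have h (a b c d e f g h : M) : cpow γ 4 (![a, b, c, d, e, f, g, h] : Fin 8 → M) =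
      24 * pfaffianEight (fun a b => γ ![a, b]) a b c d e f g h := by
    simpa only [Matrix.cons_val] using cpow_four_apply_aux γ ![g, h, a, b, c, d, e, f]
  have hv : (![v 0, v 1, v 2, v 3, v 4, v 5, v 6, v 7] : Fin 8 → M) = v := by
    ext i; fin_cases i <;> rfl
  have hc := h (v 0) (v 1) (v 2) (v 3) (v 4) (v 5) (v 6) (v 7)
  rwa [hv] at hc

end AlternatingMap
end Pfaffian

/-! ### Complex forms in coordinates and unitary invariance of their inner product -/

section Pullback

namespace CForm

variable {V : Type*} [NormedAddCommGroup V] [InnerProductSpace ℝ V] {ι : Type*}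

/-- The pullback of a complex alternating form along a real linear map into `ι → ℂ`. -/
def pullback {k : ℕ} (T : V →ₗ[ℝ] (ι → ℂ)) (γ : (ι → ℂ) [⋀^Fin k]→ₗ[ℂ] ℂ) : CForm V k where
  toFun v := γ fun i => T (v i)
  map_update_add' v i x y := by
    have h (z : V) : (fun j => T (Function.update v i z j)) =
        Function.update (fun j => T (v j)) i (T z) := by
      ext j : 1
      exact Function.apply_update (fun _ => T) v i z j
    rw [h, h, h, map_add, γ.map_update_add]
  map_update_smul' v i c x := by
    have h (z : V) : (fun j => T (Function.update v i z j)) =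
        Function.update (fun j => T (v j)) i (T z) := by
      ext j : 1
      exact Function.apply_update (fun _ => T) v i z j
    have h2 : T (c • x) = (c : ℂ) • T x := by rw [map_smul, Complex.coe_smul]
    rw [h, h, h2, γ.map_update_smul, Complex.coe_smul]
  map_eq_zero_of_eq' v i j hv hij := γ.map_eq_zero_of_eq _ (by rw [hv]) hij

variable (T : V →ₗ[ℝ] (ι → ℂ))

lemma pullback_apply {k : ℕ} (γ : (ι → ℂ) [⋀^Fin k]→ₗ[ℂ] ℂ) (v : Fin k → V) :
    pullback T γ v = γ fun i => T (v i) := rfl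

lemma pullback_sub {k : ℕ} (γ δ : (ι → ℂ) [⋀^Fin k]→ₗ[ℂ] ℂ) :
    pullback T (γ - δ) = pullback T γ - pullback T δ := rfl

lemma pullback_smul {k : ℕ} (c : ℂ) (γ : (ι → ℂ) [⋀^Fin k]→ₗ[ℂ] ℂ) :
    pullback T (c • γ) = c • pullback T γ := rfl

lemma pullback_cwedge {k l : ℕ} (γ : (ι → ℂ) [⋀^Fin k]→ₗ[ℂ] ℂ) (δ : (ι → ℂ) [⋀^Fin l]→ₗ[ℂ] ℂ) :
    pullback T (γ.cwedge δ) = wedge (pullback T γ) (pullback T δ) := by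
  ext v
  change LinearMap.mul' ℂ ℂ (γ.domCoprod δ fun i => T (v (finSumFinEquiv i))) =
    LinearMap.mul' ℝ ℂ ((pullback T γ).domCoprod (pullback T δ) fun i => v (finSumFinEquiv i))
  rw [AlternatingMap.domCoprod_apply, AlternatingMap.domCoprod_apply, sum_apply,
    sum_apply, map_sum, map_sum]
  refine Finset.sum_congr rfl fun σ _ => ?_
  induction σ using Quotient.inductionOn' with
  | h σ =>
    rw [AlternatingMap.domCoprod.summand_mk'', AlternatingMap.domCoprod.summand_mk'',
      smul_apply, smul_apply, Units.smul_def, Units.smul_def,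
      map_zsmul, map_zsmul]
    rfl

lemma pullback_cpow (γ : (ι → ℂ) [⋀^Fin 2]→ₗ[ℂ] ℂ) (r : ℕ) :
    pullback T (γ.cpow r) = pow (pullback T γ) r := by
  induction r with
  | zero => rfl
  | succ r ih =>
    rw [AlternatingMap.cpow, pow, pullback_cwedge, ih]

variable [DecidableEq ι]

/-- The components of a complex form on the standard basis. -/
def comp {k : ℕ} (γ : (ι → ℂ) [⋀^Fin k]→ₗ[ℂ] ℂ) (g : Fin k → ι) : ℂ :=
  γ fun i => Pi.single (g i) 1

lemma comp_perm {k : ℕ} (γ : (ι → ℂ) [⋀^Fin k]→ₗ[ℂ] ℂ) (g : Fin k → ι) (σ : Equiv.Perm (Fin k)) :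
    comp γ (g ∘ σ) = Equiv.Perm.sign σ • comp γ g :=
  γ.map_perm (fun i => Pi.single (g i) 1) σ

lemma comp_eq_zero {k : ℕ} (γ : (ι → ℂ) [⋀^Fin k]→ₗ[ℂ] ℂ) {g : Fin k → ι}
    (hg : ¬ Function.Injective g) : comp γ g = 0 := by
  obtain ⟨i, j, hij, hne⟩ : ∃ i j, g i = g j ∧ i ≠ j := by
    simpa [Function.Injective] using hg
  exact γ.map_eq_zero_of_eq _ (by rw [hij]) hne

variable [Fintype ι]

omit [DecidableEq ι] [Fintype ι] in
lemma comp_consEquiv {k : ℕ} {A : Type*} (w : A → ι → ℂ) (x : A) (f : Fin k → A) :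
    (fun i => w ((Fin.consEquiv fun _ : Fin (k + 1) => A) (x, f) i)) =
      Fin.cons (w x) fun i => w (f i) := by
  ext i
  induction i using Fin.cases <;> rfl

/-- The hypothesis makes `u` a Parseval family of `ι → ℂ`. For linear forms the claim is Parseval's
identity (`hlin`); for multilinear maps it is applied one slot at a time, by currying the first one.
-/
lemma sum_conj_mul_unitary {κ : Type*} [Fintype κ] {u : κ → ι → ℂ}
    (hu : ∀ a b, ∑ i, starRingEnd ℂ (u i a) * u i b = if a = b then 1 else 0) {k : ℕ}
    (γ δ : MultilinearMap ℂ (fun _ : Fin k => ι → ℂ) ℂ) :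
    ∑ f : Fin k → κ, starRingEnd ℂ (γ fun i => u (f i)) * δ (fun i => u (f i)) =
      ∑ g : Fin k → ι, starRingEnd ℂ (γ fun i => Pi.single (g i) 1) *
        δ (fun i => Pi.single (g i) 1) := by
  induction k with
  | zero => simp [Subsingleton.elim _ (fun i : Fin 0 => (0 : ι → ℂ))]
  | succ k ih =>
    have hlin (φ ψ : (ι → ℂ) →ₗ[ℂ] ℂ) : ∑ i, starRingEnd ℂ (φ (u i)) * ψ (u i) =
        ∑ a, starRingEnd ℂ (φ (Pi.single a 1)) * ψ (Pi.single a 1) := by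
      have hφ (φ : (ι → ℂ) →ₗ[ℂ] ℂ) (x : ι → ℂ) : φ x = ∑ a, x a * φ (Pi.single a 1) := by
        conv_lhs => rw [← LinearMap.sum_single_apply (fun _ : ι => ℂ) x, map_sum]
        refine Finset.sum_congr rfl fun a _ => ?_
        rw [← smul_eq_mul, ← map_smul]
        congr 1
        ext b
        simp [Pi.single_apply]
      calc ∑ i, starRingEnd ℂ (φ (u i)) * ψ (u i)
          = ∑ i, ∑ a, ∑ b, (starRingEnd ℂ (u i a) * u i b) *
              (starRingEnd ℂ (φ (Pi.single a 1)) * ψ (Pi.single b 1)) := by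
            refine Finset.sum_congr rfl fun i _ => ?_
            rw [hφ φ (u i), hφ ψ (u i), map_sum, Finset.sum_mul_sum]
            refine Finset.sum_congr rfl fun a _ => Finset.sum_congr rfl fun b _ => ?_
            rw [map_mul]; ring
        _ = ∑ a, ∑ b, (∑ i, starRingEnd ℂ (u i a) * u i b) *
              (starRingEnd ℂ (φ (Pi.single a 1)) * ψ (Pi.single b 1)) := by
            rw [Finset.sum_comm]
            refine Finset.sum_congr rfl fun a _ => ?_
            rw [Finset.sum_comm]
            simp only [Finset.sum_mul]
        _ = _ := by simp [hu]
    rw [← (Fin.consEquiv fun _ : Fin (k + 1) => κ).sum_comp,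
      ← (Fin.consEquiv fun _ : Fin (k + 1) => ι).sum_comp, Fintype.sum_prod_type,
      Fintype.sum_prod_type]
    let ev (γ : MultilinearMap ℂ (fun _ : Fin (k + 1) => ι → ℂ) ℂ) (g : Fin k → ι) :
        (ι → ℂ) →ₗ[ℂ] ℂ :=
      { toFun := fun x => γ.curryLeft x fun j => Pi.single (g j) 1
        map_add' := fun x y => by rw [map_add]; rfl
        map_smul' := fun c x => by rw [map_smul]; rfl }
    calc _ = ∑ i, ∑ f : Fin k → κ, starRingEnd ℂ (γ.curryLeft (u i) fun j => u (f j)) *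
          δ.curryLeft (u i) (fun j => u (f j)) := by
          simp only [comp_consEquiv u, MultilinearMap.curryLeft_apply]
      _ = ∑ i, ∑ g : Fin k → ι, starRingEnd ℂ (γ.curryLeft (u i) fun j => Pi.single (g j) 1) *
          δ.curryLeft (u i) (fun j => Pi.single (g j) 1) := by simp only [ih]
      _ = ∑ g : Fin k → ι, ∑ i, starRingEnd ℂ (γ.curryLeft (u i) fun j => Pi.single (g j) 1) *
          δ.curryLeft (u i) (fun j => Pi.single (g j) 1) := Finset.sum_comm
      _ = ∑ g : Fin k → ι, ∑ a, starRingEnd ℂ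
          (γ.curryLeft (Pi.single a 1) fun j => Pi.single (g j) 1) *
          δ.curryLeft (Pi.single a 1) (fun j => Pi.single (g j) 1) :=
          Finset.sum_congr rfl fun g _ => hlin (ev γ g) (ev δ g)
      _ = _ := by
          rw [Finset.sum_comm]
          simp only [comp_consEquiv (fun a => (Pi.single a 1 : ι → ℂ)),
            MultilinearMap.curryLeft_apply]

end CForm
end Pullback

/-! ### Components of a form and their types -/

section Types

namespace CForm

variable {V : Type*} [NormedAddCommGroup V] [InnerProductSpace ℝ V] [FiniteDimensional ℝ V]
  {ι : Type*} [DecidableEq ι] [Fintype ι] {T : V →ₗ[ℝ] (ι → ℂ)}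

/-- A one-sided inverse of a square matrix is two-sided: the isometry gives A B = 1, the equality of
dimensions gives B A = 1. -/
lemma unitary_of_isometry (hT : ∀ u v, ∑ a, starRingEnd ℂ (T u a) * T v a = (inner ℝ u v : ℝ))
    (hι : Fintype.card ι = finrank ℝ V) (a b : ι) :
    ∑ i, starRingEnd ℂ (T (stdOrthonormalBasis ℝ V i) a) * T (stdOrthonormalBasis ℝ V i) b =
      if a = b then 1 else 0 := by
  let A : Matrix (Fin (finrank ℝ V)) ι ℂ :=
    Matrix.of fun i a => starRingEnd ℂ (T (stdOrthonormalBasis ℝ V i) a)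
  let B : Matrix ι (Fin (finrank ℝ V)) ℂ := Matrix.of fun a i => T (stdOrthonormalBasis ℝ V i) a
  have h : A * B = 1 := by
    ext i j
    rw [Matrix.mul_apply, Matrix.one_apply]
    refine (hT _ _).trans ?_
    rw [orthonormal_iff_ite.1 (stdOrthonormalBasis ℝ V).orthonormal]
    split_ifs <;> simp
  have h2 : B * A = 1 := (Matrix.mul_eq_one_comm_of_card_eq _ _ _ (by simp [hι])).1 h
  have h3 := congrFun (congrFun h2 b) a
  rw [Matrix.mul_apply, Matrix.one_apply] at h3
  simp only [eq_comm (a := b)] at h3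
  rw [← h3]
  exact Finset.sum_congr rfl fun i _ => mul_comm _ _

variable (hT : ∀ a b, ∑ i, starRingEnd ℂ (T (stdOrthonormalBasis ℝ V i) a) *
  T (stdOrthonormalBasis ℝ V i) b = if a = b then 1 else 0)

include hT

lemma inner_pullback {k : ℕ} (γ δ : (ι → ℂ) [⋀^Fin k]→ₗ[ℂ] ℂ) :
    inner ℂ (pullback T γ) (pullback T δ) =
      (k.factorial : ℂ)⁻¹ * ∑ g : Fin k → ι, starRingEnd ℂ (comp γ g) * comp δ g :=
  congrArg (fun z : ℂ => (k.factorial : ℂ)⁻¹ * z)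
    (sum_conj_mul_unitary hT γ.toMultilinearMap δ.toMultilinearMap)

lemma norm_sq_pullback {k : ℕ} (γ : (ι → ℂ) [⋀^Fin k]→ₗ[ℂ] ℂ) :
    ‖pullback T γ‖ ^ 2 = (k.factorial : ℝ)⁻¹ * ∑ g : Fin k → ι, ‖comp γ g‖ ^ 2 := by
  rw [← Complex.ofReal_inj]
  have h := inner_self_eq_norm_sq_to_K (𝕜 := ℂ) (pullback T γ)
  rw [inner_pullback hT] at h
  simpa [Complex.conj_mul'] using h.symm

omit hT [FiniteDimensional ℝ V]

/-- The form `w ↦ det (wᵢ (g j))`. -/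
def detForm {k : ℕ} (g : Fin k → ι) : (ι → ℂ) [⋀^Fin k]→ₗ[ℂ] ℂ :=
  Matrix.detRowAlternating.compLinearMap (LinearMap.funLeft ℂ ℂ g)

omit [Fintype ι] [DecidableEq ι] in
lemma detForm_apply {k : ℕ} (g : Fin k → ι) (w : Fin k → ι → ℂ) :
    detForm g w = (Matrix.of fun i j => w i (g j)).det := rfl

omit [Fintype ι] [DecidableEq ι] in
lemma pullback_detForm {k : ℕ} (g : Fin k → ι) :
    pullback T (detForm g) = wedgeOne fun j => (LinearMap.proj (g j) : (ι → ℂ) →ₗ[ℝ] ℂ) ∘ₗ T :=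
  rfl

omit [Fintype ι] [DecidableEq ι] in
lemma alternatingMap_sum_apply {κ : Type*} [Fintype κ] {k : ℕ}
    (f : κ → (ι → ℂ) [⋀^Fin k]→ₗ[ℂ] ℂ) (w : Fin k → ι → ℂ) : (∑ i, f i) w = ∑ i, f i w :=
  map_sum ({ toFun := fun δ => δ w, map_zero' := rfl, map_add' := fun _ _ => rfl } :
    ((ι → ℂ) [⋀^Fin k]→ₗ[ℂ] ℂ) →+ ℂ) f Finset.univ

/-- The expansion in the basis of decomposable forms, summed over all multi-indices rather than the
increasing ones, hence the k!. Expanding the determinants, each permutation contributes one copy of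
`γ w` after reindexing. -/
lemma factorial_smul_eq_sum {k : ℕ} (γ : (ι → ℂ) [⋀^Fin k]→ₗ[ℂ] ℂ) :
    (k.factorial : ℂ) • γ = ∑ g : Fin k → ι, comp γ g • detForm g := by
  ext w
  have hγ : γ w = ∑ g : Fin k → ι, (∏ i, w i (g i)) * comp γ g := by
    have h1 (i : Fin k) : w i = ∑ a, w i a • (Pi.single a 1 : ι → ℂ) := by
      ext b; simp [Finset.sum_apply, Pi.single_apply]
    conv_lhs => rw [funext h1]
    refine (γ.toMultilinearMap.map_sum _).trans (Finset.sum_congr rfl fun g _ => ?_)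
    exact γ.toMultilinearMap.map_smul_univ _ _
  rw [AlternatingMap.smul_apply, alternatingMap_sum_apply]
  simp only [AlternatingMap.smul_apply, detForm_apply, Matrix.det_apply, smul_eq_mul,
    Finset.mul_sum]
  rw [Finset.sum_comm]
  have hσ (σ : Equiv.Perm (Fin k)) : ∑ g : Fin k → ι, comp γ g *
      (Equiv.Perm.sign σ • ∏ i, (Matrix.of fun i j => w i (g j)) (σ i) i) = γ w := by
    rw [hγ, ← (Equiv.arrowCongr σ.symm (Equiv.refl ι)).sum_comp]
    refine Finset.sum_congr rfl fun g _ => ?_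
    have h1 : (Equiv.arrowCongr σ.symm (Equiv.refl ι)) g = g ∘ σ := rfl
    have h2 : ∏ i, w (σ i) (g (σ i)) = ∏ i, w i (g i) := Equiv.prod_comp σ fun i => w i (g i)
    rw [h1, comp_perm]
    change Equiv.Perm.sign σ • comp γ g * (Equiv.Perm.sign σ • ∏ i, w (σ i) (g (σ i))) = _
    rw [h2, smul_mul_smul_comm, Int.units_mul_self, one_smul, mul_comm]
  rw [Finset.sum_congr rfl fun σ _ => hσ σ]
  simp [Fintype.card_perm]

variable (L : ι → Bool)

/-- The number of indices of a multi-index which belong to `dz₁, …, dzₙ`. -/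
def typeCount {k : ℕ} (g : Fin k → ι) : ℕ := (Finset.univ.filter fun i => L (g i) = true).card

omit [Fintype ι] [DecidableEq ι] in
lemma typeCount_perm {k : ℕ} (g h : Fin k → ι) (σ : Equiv.Perm (Fin k))
    (hσ : ∀ i, h (σ i) = g i) : typeCount L g = typeCount L h := by
  refine Finset.card_bij (fun i _ => σ i) (fun i hi => ?_) (fun i _ j _ h => σ.injective h)
    fun j hj => ⟨σ.symm j, ?_, σ.apply_symm_apply j⟩
  · simpa [hσ] using hi
  · simpa [← hσ] using hj

omit [Fintype ι] in
-- A nonzero determinant has a nonzero term in its Leibniz expansion, and the permutation of that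
-- term rearranges `g` into `h`.
lemma typeCount_eq_of_comp_detForm {k : ℕ} {g h : Fin k → ι} (hgh : comp (detForm g) h ≠ 0) :
    typeCount L g = typeCount L h := by
  rw [comp, detForm_apply, Matrix.det_apply] at hgh
  obtain ⟨σ, -, hσ⟩ := Finset.exists_ne_zero_of_sum_ne_zero hgh
  have h1 : ∏ i, (Matrix.of fun i j => (Pi.single (h i) 1 : ι → ℂ) (g j)) (σ i) i ≠ 0 :=
    fun h0 => hσ (by rw [h0, smul_zero])
  rw [Finset.prod_ne_zero_iff] at h1
  refine typeCount_perm L g h σ fun i => ?_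
  have := h1 i (Finset.mem_univ i)
  by_contra hne
  exact this (by simp [Pi.single_apply, Ne.symm hne])

/-- The components of `γ` of the types selected by `P`. -/
def typePart (P : ℕ → Prop) [DecidablePred P] {k : ℕ} (γ : (ι → ℂ) [⋀^Fin k]→ₗ[ℂ] ℂ) :
    (ι → ℂ) [⋀^Fin k]→ₗ[ℂ] ℂ :=
  (k.factorial : ℂ)⁻¹ • ∑ g : Fin k → ι,
    (if P (typeCount L g) then comp γ g else 0) • detForm g

/-- A component of `detForm g` at `h` vanishes unless `g` and `h` have the same type, so the
condition on `g` may be replaced by the condition on `h` and taken out of the sum. -/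
lemma comp_typePart (P : ℕ → Prop) [DecidablePred P] {k : ℕ} (γ : (ι → ℂ) [⋀^Fin k]→ₗ[ℂ] ℂ)
    (h : Fin k → ι) :
    comp (typePart L P γ) h = if P (typeCount L h) then comp γ h else 0 := by
  have hk : (k.factorial : ℂ) ≠ 0 := by exact_mod_cast k.factorial_ne_zero
  have h1 := congrArg (fun δ => comp δ h) (factorial_smul_eq_sum γ)
  have hs (c : (Fin k → ι) → ℂ) :
      comp (∑ g, c g • detForm g) h = ∑ g, c g * comp (detForm g) h := by
    rw [comp, alternatingMap_sum_apply]; rfl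
  have h2 : comp ((k.factorial : ℂ) • γ) h = k.factorial * comp γ h := rfl
  have h3 : comp (typePart L P γ) h = (k.factorial : ℂ)⁻¹ *
    comp (∑ g : Fin k → ι, (if P (typeCount L g) then comp γ g else 0) • detForm g) h := rfl
  simp only [hs, h2] at h1
  rw [h3, hs, inv_mul_eq_iff_eq_mul₀ hk]
  have h4 (g : Fin k → ι) : (if P (typeCount L g) then comp γ g else 0) * comp (detForm g) h =
      if P (typeCount L h) then comp γ g * comp (detForm g) h else 0 := by
    by_cases h0 : comp (detForm g) h = 0
    · simp [h0]
    · rw [typeCount_eq_of_comp_detForm L h0, ite_mul, zero_mul]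
  rw [Finset.sum_congr rfl fun g _ => h4 g]
  split_ifs
  · exact h1.symm
  · simp

variable {J : V →ₗ[ℝ] V} (hJ : ∀ v a, T (J v) a = (if L a then Complex.I else -Complex.I) * T v a)

include hJ

omit [Fintype ι] [DecidableEq ι] in
-- The generators of `typeSubspace` list their (1,0)-factors first; a permutation brings `detForm g`
-- to that shape and changes it by a sign only.
lemma pullback_detForm_mem {k p q : ℕ} (hk : p + q = k) {g : Fin k → ι} (hg : typeCount L g = p) :
    pullback T (detForm g) ∈ typeSubspace J p q (k := k) := by
  obtain ⟨σ, hσ⟩ : ∃ σ : Equiv.Perm (Fin k), ∀ i, L (g (σ i)) = true ↔ (i : ℕ) < p := by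
    have hcard : Fintype.card {i : Fin k // (i : ℕ) < p} = Fintype.card {i // L (g i) = true} := by
      rw [Fintype.card_subtype, Fintype.card_subtype, ← typeCount, hg, Fin.card_filter_val_lt]
      omega
    let e := Fintype.equivOfCardEq hcard
    refine ⟨e.extendSubtype, fun i => ⟨fun h => ?_, fun h => e.extendSubtype_mem i h⟩⟩
    by_contra hi
    exact e.extendSubtype_not_mem i hi h
  have h1 : detForm (g ∘ σ) = Equiv.Perm.sign σ • detForm g := by
    ext w
    rw [detForm_apply, AlternatingMap.smul_apply, detForm_apply, Units.smul_def, zsmul_eq_mul,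
      ← Matrix.det_permute']
    rfl
  have h2 : detForm g = ((Equiv.Perm.sign σ : ℤ) : ℂ) • detForm (g ∘ σ) := by
    rw [h1, Units.smul_def, ← Int.cast_smul_eq_zsmul ℂ, smul_smul, ← Int.cast_mul, ← Units.val_mul,
      Int.units_mul_self]
    simp
  rw [h2, pullback_smul]
  refine Submodule.smul_mem _ _ (Submodule.subset_span ⟨hk, _, fun i hi v => ?_, fun i hi v => ?_,
    pullback_detForm _⟩)
  · change T (J v) (g (σ i)) = Complex.I * T v (g (σ i))
    rw [hJ, if_pos ((hσ i).2 hi)]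
  · change T (J v) (g (σ i)) = -Complex.I * T v (g (σ i))
    rw [hJ, if_neg fun h => not_lt.2 hi ((hσ i).1 h)]

end CForm
end Types

/-! ### The orthogonal projection onto forms of given types -/

section Projection

namespace CForm

variable {V : Type*} [NormedAddCommGroup V] [InnerProductSpace ℝ V] [FiniteDimensional ℝ V]
  {ι : Type*} [DecidableEq ι] [Fintype ι] {T : V →ₗ[ℝ] (ι → ℂ)}

/-- The coefficients of a complex one-form in the coframe given by the components of `T`. -/
def coframeCoeff (T : V →ₗ[ℝ] (ι → ℂ)) (f : V →ₗ[ℝ] ℂ) (a : ι) : ℂ :=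
  ∑ i, f (stdOrthonormalBasis ℝ V i) * starRingEnd ℂ (T (stdOrthonormalBasis ℝ V i) a)

omit [DecidableEq ι] in
lemma sum_coframeCoeff (hT : ∀ u v, ∑ a, starRingEnd ℂ (T u a) * T v a = (inner ℝ u v : ℝ))
    (f : V →ₗ[ℝ] ℂ) (v : V) : ∑ a, coframeCoeff T f a * T v a = f v := by
  conv_rhs => rw [← (stdOrthonormalBasis ℝ V).sum_repr' v, map_sum]
  simp only [coframeCoeff, Finset.sum_mul]
  rw [Finset.sum_comm]
  refine Finset.sum_congr rfl fun i _ => ?_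
  rw [map_smul, ← Complex.coe_smul, smul_eq_mul, ← hT, Finset.sum_mul]
  exact Finset.sum_congr rfl fun a _ => by ring

variable (hT : ∀ u v, ∑ a, starRingEnd ℂ (T u a) * T v a = (inner ℝ u v : ℝ))
  (hι : Fintype.card ι = finrank ℝ V) (L : ι → Bool) {J : V →ₗ[ℝ] V}
  (hJ : ∀ v a, T (J v) a = (if L a then Complex.I else -Complex.I) * T v a)

include hT hι hJ

/-- Comparing the expansions of f ∘ J and c f gives a linear relation between the components of `T`,
and these are independent by unitarity. So a (1,0)-form involves only the dz_j, and a (0,1)-form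
only the dz̄_j. -/
lemma coframeCoeff_mul_eq_zero {f : V →ₗ[ℝ] ℂ} {c : ℂ} (hf : ∀ v, f (J v) = c * f v) (b : ι) :
    coframeCoeff T f b * ((if L b then Complex.I else -Complex.I) - c) = 0 := by
  have hU := unitary_of_isometry hT hι
  have h1 (v : V) : ∑ a, coframeCoeff T f a * ((if L a then Complex.I else -Complex.I) - c) *
      T v a = 0 := by
    have h2 := hf v
    rw [← sum_coframeCoeff hT f (J v), ← sum_coframeCoeff hT f v, Finset.mul_sum, ← sub_eq_zero,
      ← Finset.sum_sub_distrib] at h2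
    rw [← h2]
    refine Finset.sum_congr rfl fun a _ => ?_
    rw [hJ]; ring
  calc _ = ∑ a, coframeCoeff T f a * ((if L a then Complex.I else -Complex.I) - c) *
        (if b = a then 1 else 0) := by simp
    _ = ∑ i, starRingEnd ℂ (T (stdOrthonormalBasis ℝ V i) b) *
        ∑ a, coframeCoeff T f a * ((if L a then Complex.I else -Complex.I) - c) *
          T (stdOrthonormalBasis ℝ V i) a := by
        simp only [← hU b, Finset.mul_sum]
        rw [Finset.sum_comm]
        exact Finset.sum_congr rfl fun i _ => Finset.sum_congr rfl fun a _ => by ring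
    _ = 0 := by simp [h1]

/-- Written in the coframe of `T`, a generator of type (p, k - p) is a determinant form whose
components vanish at all multi-indices of other types. The components of `γ` vanish at the remaining
ones, so no term of the inner product survives. -/
lemma inner_wedgeOne_pullback {k p : ℕ} (hp : p ≤ k) {f : Fin k → V →ₗ[ℝ] ℂ}
    (hf1 : ∀ i : Fin k, (i : ℕ) < p → ∀ v, f i (J v) = Complex.I * f i v)
    (hf2 : ∀ i : Fin k, p ≤ (i : ℕ) → ∀ v, f i (J v) = -Complex.I * f i v)
    {γ : (ι → ℂ) [⋀^Fin k]→ₗ[ℂ] ℂ} (hγ : ∀ g, typeCount L g = p → comp γ g = 0) :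
    inner ℂ (wedgeOne f) (pullback T γ) = 0 := by
  let Λ : (ι → ℂ) →ₗ[ℂ] (Fin k → ℂ) :=
    LinearMap.pi fun j => ∑ a, coframeCoeff T (f j) a • LinearMap.proj a
  have hΛ (j : Fin k) (w : ι → ℂ) : Λ w j = ∑ a, coframeCoeff T (f j) a * w a := by
    simp [Λ]
  let δ : (ι → ℂ) [⋀^Fin k]→ₗ[ℂ] ℂ := Matrix.detRowAlternating.compLinearMap Λ
  have hδ : wedgeOne f = pullback T δ := by
    ext v
    change (Matrix.of fun i j => f j (v i)).det = (Matrix.of fun i j => Λ (T (v i)) j).det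
    congr 1
    ext i j
    simp only [Matrix.of_apply]
    rw [hΛ, sum_coframeCoeff hT]
  have hcomp (g : Fin k → ι) (hg : comp δ g ≠ 0) : typeCount L g = p := by
    change (Matrix.of fun i j => Λ (Pi.single (g i) 1) j).det ≠ 0 at hg
    rw [Matrix.det_apply] at hg
    obtain ⟨σ, -, hσ⟩ := Finset.exists_ne_zero_of_sum_ne_zero hg
    have h1 : ∏ i, (Matrix.of fun i j => Λ (Pi.single (g i) 1) j) (σ i) i ≠ 0 :=
      fun h0 => hσ (by rw [h0, smul_zero])
    rw [Finset.prod_ne_zero_iff] at h1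
    have h2 (i : Fin k) : coframeCoeff T (f i) (g (σ i)) ≠ 0 := by
      have h3 := h1 i (Finset.mem_univ i)
      simp only [Matrix.of_apply] at h3
      rw [hΛ] at h3
      simpa [Pi.single_apply] using h3
    have h3 (i : Fin k) : L (g (σ i)) = true ↔ (i : ℕ) < p := by
      constructor
      · intro hL
        by_contra hi
        have := coframeCoeff_mul_eq_zero hT hι L hJ (hf2 i (not_lt.1 hi)) (g (σ i))
        rw [if_pos hL, mul_eq_zero] at this
        refine (this.resolve_left (h2 i) : _) |> fun h => ?_
        have h5 := congrArg Complex.im h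
        norm_num at h5
      · intro hi
        by_contra hL
        have := coframeCoeff_mul_eq_zero hT hι L hJ (hf1 i hi) (g (σ i))
        rw [if_neg hL, mul_eq_zero] at this
        refine (this.resolve_left (h2 i) : _) |> fun h => ?_
        have h5 := congrArg Complex.im h
        norm_num at h5
    rw [← typeCount_perm L (g ∘ σ) g σ fun i => rfl]
    calc typeCount L (g ∘ σ) = (Finset.univ.filter fun i : Fin k => (i : ℕ) < p).card := by
          rw [typeCount]; congr 1; ext i; simpa using h3 i
      _ = p := by rw [Fin.card_filter_val_lt]; omega
  rw [hδ, inner_pullback (unitary_of_isometry hT hι)]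
  refine mul_eq_zero_of_right _ (Finset.sum_eq_zero fun g _ => ?_)
  by_cases h : comp δ g = 0
  · rw [h, map_zero, zero_mul]
  · rw [hγ g (hcomp g h), mul_zero]

/-- The projection of a form to its components of type `(p, q)` and `(q, p)`. -/
lemma bracketProj_pullback {k p q : ℕ} (hk : p + q = k) (γ : (ι → ℂ) [⋀^Fin k]→ₗ[ℂ] ℂ) :
    bracketProj J p q (pullback T γ) =
      pullback T (typePart L (fun n => n = p ∨ n = q) γ) := by
  -- The projection is characterised by two facts: the selected part lies in the subspace, and the
  -- remainder is orthogonal to it.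
  refine Submodule.eq_starProjection_of_mem_of_inner_eq_zero ?_ ?_
  · rw [typePart, pullback_smul]
    refine Submodule.smul_mem _ _ ?_
    have hsum (c : (Fin k → ι) → ℂ) : pullback T (∑ g, c g • detForm g) =
        ∑ g, c g • pullback T (detForm g) := by
      refine map_sum ({ toFun := pullback T, map_zero' := rfl, map_add' := fun _ _ => rfl } :
        ((ι → ℂ) [⋀^Fin k]→ₗ[ℂ] ℂ) →+ CForm V k) _ _
    rw [hsum]
    refine Submodule.sum_mem _ fun g _ => ?_
    split_ifs with h
    · refine Submodule.smul_mem _ _ ?_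
      rcases h with h | h
      · exact Submodule.mem_sup_left (pullback_detForm_mem L hJ hk h)
      · exact Submodule.mem_sup_right (pullback_detForm_mem L hJ (by omega) h)
    · rw [zero_smul]; exact Submodule.zero_mem _
  · intro β hβ
    rw [← pullback_sub]
    have h0 (g : Fin k → ι) (hg : typeCount L g = p ∨ typeCount L g = q) :
        comp (γ - typePart L (fun n => n = p ∨ n = q) γ) g = 0 := by
      change comp γ g - comp (typePart L (fun n => n = p ∨ n = q) γ) g = 0
      rw [comp_typePart, if_pos hg, sub_self]
    -- Orthogonality to the remainder need only be tested on the generators of both types.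
    have key : typeSubspace J p q ⊔ typeSubspace J q p ≤
        (ℂ ∙ pullback T (γ - typePart L (fun n => n = p ∨ n = q) γ))ᗮ := by
      refine sup_le ?_ ?_ <;>
      · refine Submodule.span_le.2 ?_
        rintro _ ⟨hpq, f, hf1, hf2, rfl⟩
        rw [SetLike.mem_coe, Submodule.mem_orthogonal_singleton_iff_inner_left]
        exact inner_wedgeOne_pullback hT hι L hJ (by omega) hf1 hf2 fun g hg =>
          h0 g (by simp [hg])
    have := Submodule.mem_orthogonal_singleton_iff_inner_right.1 (key hβ)
    exact this

lemma norm_sq_bracketProj_pullback {k p q : ℕ} (hk : p + q = k)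
    (γ : (ι → ℂ) [⋀^Fin k]→ₗ[ℂ] ℂ) :
    ‖bracketProj J p q (pullback T γ)‖ ^ 2 = (k.factorial : ℝ)⁻¹ * ∑ g : Fin k → ι,
      if typeCount L g = p ∨ typeCount L g = q then ‖comp γ g‖ ^ 2 else 0 := by
  rw [bracketProj_pullback hT hι L hJ hk, norm_sq_pullback (unitary_of_isometry hT hι)]
  congr 1
  refine Finset.sum_congr rfl fun g _ => ?_
  rw [comp_typePart]
  split_ifs <;> simp

end CForm

/-- The map (i, σ) ↦ G i ∘ σ is injective, since the image set determines i and then injectivity of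
`G i` determines σ; it reaches every multi-index where `F` is nonzero. This passes from all
multi-indices to increasing ones and cancels the 1/k! of the norm. -/
lemma sum_eq_factorial_mul_sum {ι κ : Type*} [Fintype ι] [DecidableEq ι] [Fintype κ] {k : ℕ}
    {F : (Fin k → ι) → ℝ} (hF : ∀ g (σ : Equiv.Perm (Fin k)), F (g ∘ σ) = F g)
    {G : κ → Fin k → ι} (hG : ∀ i, Function.Injective (G i))
    (hGG : ∀ i j, Finset.univ.image (G i) = Finset.univ.image (G j) → i = j)
    (hFG : ∀ g, F g ≠ 0 → Function.Injective g ∧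
      ∃ i, Finset.univ.image (G i) = Finset.univ.image g) :
    ∑ g, F g = k.factorial * ∑ i, F (G i) := by
  have himage (g : Fin k → ι) (σ : Equiv.Perm (Fin k)) :
      Finset.univ.image (g ∘ σ) = Finset.univ.image g := by
    rw [← Finset.image_image, Finset.image_univ_equiv]
  have h : ∑ x : κ × Equiv.Perm (Fin k), F (G x.1 ∘ x.2) = ∑ g, F g := by
    refine Finset.sum_of_injOn (fun x => G x.1 ∘ x.2) ?_ (fun _ _ => Finset.mem_coe.2
      (Finset.mem_univ _)) ?_ fun _ _ => rfl
    · rintro ⟨i, σ⟩ - ⟨j, τ⟩ - hij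
      have hij' : G i ∘ σ = G j ∘ τ := hij
      have h1 : i = j := hGG i j (by rw [← himage (G i) σ, ← himage (G j) τ, hij'])
      subst h1
      have h2 : σ = τ := Equiv.ext fun x => hG i (congrFun hij' x)
      rw [h2]
    · intro g _ hg
      by_contra hne
      obtain ⟨hinj, i, hi⟩ := hFG g hne
      have hr : Set.range (G i) = Set.range g := by
        have := congrArg (fun s : Finset ι => (s : Set ι)) hi
        simpa using this
      let σ : Equiv.Perm (Fin k) := (Equiv.ofInjective g hinj).trans
        ((Equiv.setCongr hr.symm).trans (Equiv.ofInjective (G i) (hG i)).symm)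
      refine hg ⟨(i, σ), Finset.mem_coe.2 (Finset.mem_univ _), ?_⟩
      ext x
      exact congrArg Subtype.val ((Equiv.ofInjective (G i) (hG i)).apply_symm_apply
        ((Equiv.setCongr hr.symm) (Equiv.ofInjective g hinj x)))
  rw [← h, Fintype.sum_prod_type]
  simp [hF, Fintype.card_perm, Finset.mul_sum]

end Projection

/-! ### Increasing multi-indices in complex dimension 4 and the resulting norms -/

section Families

open Sum (inl inr)

/-- The indices `1, …, 4, 1̄, …, 4̄`. -/
def topIndex : Fin 8 → Fin 4 ⊕ Fin 4 :=
  ![inl 0, inl 1, inl 2, inl 3, inr 0, inr 1, inr 2, inr 3]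

/-- The increasing multi-indices of types `(4, 2)` and `(2, 4)`. -/
def sixIndex : Fin 6 × Bool → Fin 6 → Fin 4 ⊕ Fin 4
  | (0, true) => ![inl 0, inl 1, inl 2, inl 3, inr 0, inr 1]
  | (1, true) => ![inl 0, inl 1, inl 2, inl 3, inr 0, inr 2]
  | (2, true) => ![inl 0, inl 1, inl 2, inl 3, inr 0, inr 3]
  | (3, true) => ![inl 0, inl 1, inl 2, inl 3, inr 1, inr 2]
  | (4, true) => ![inl 0, inl 1, inl 2, inl 3, inr 1, inr 3]
  | (5, true) => ![inl 0, inl 1, inl 2, inl 3, inr 2, inr 3]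
  | (0, false) => ![inl 0, inl 1, inr 0, inr 1, inr 2, inr 3]
  | (1, false) => ![inl 0, inl 2, inr 0, inr 1, inr 2, inr 3]
  | (2, false) => ![inl 0, inl 3, inr 0, inr 1, inr 2, inr 3]
  | (3, false) => ![inl 1, inl 2, inr 0, inr 1, inr 2, inr 3]
  | (4, false) => ![inl 1, inl 3, inr 0, inr 1, inr 2, inr 3]
  | (5, false) => ![inl 2, inl 3, inr 0, inr 1, inr 2, inr 3]

/-- The increasing multi-indices of types `(4, 0)` and `(0, 4)`. -/
def fourIndex : Bool → Fin 4 → Fin 4 ⊕ Fin 4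
  | true => inl
  | false => inr

lemma sixIndex_injective (i : Fin 6 × Bool) : Function.Injective (sixIndex i) := by
  revert i; decide +kernel

lemma image_sixIndex_injective (i j : Fin 6 × Bool)
    (h : Finset.univ.image (sixIndex i) = Finset.univ.image (sixIndex j)) : i = j := by
  revert i j; decide +kernel

lemma exists_image_sixIndex (s : Finset (Fin 4 ⊕ Fin 4)) (hs : s.card = 6)
    (hs' : (s.filter fun a => a.isLeft = true).card = 4 ∨
      (s.filter fun a => a.isLeft = true).card = 2) :
    ∃ i, Finset.univ.image (sixIndex i) = s := by
  revert s; decide +kernel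

lemma exists_image_fourIndex (s : Finset (Fin 4 ⊕ Fin 4)) (hs : s.card = 4)
    (hs' : (s.filter fun a => a.isLeft = true).card = 4 ∨
      (s.filter fun a => a.isLeft = true).card = 0) :
    ∃ i, Finset.univ.image (fourIndex i) = s := by
  revert s; decide +kernel

lemma typeCount_eq_card_filter_image {ι : Type*} [DecidableEq ι] (L : ι → Bool) {k : ℕ}
    {g : Fin k → ι} (hg : Function.Injective g) :
    CForm.typeCount L g = ((Finset.univ.image g).filter fun a => L a = true).card := by
  rw [Finset.filter_image, Finset.card_image_of_injective _ hg, CForm.typeCount]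

namespace CForm

variable {V : Type*} [NormedAddCommGroup V] [InnerProductSpace ℝ V] [FiniteDimensional ℝ V]
  {T : V →ₗ[ℝ] (Fin 4 ⊕ Fin 4 → ℂ)}
  (hT : ∀ u v, ∑ a, starRingEnd ℂ (T u a) * T v a = (inner ℝ u v : ℝ))
  (hV : finrank ℝ V = 8) {J : V →ₗ[ℝ] V}
  (hJ : ∀ v a, T (J v) a = (if a.isLeft then Complex.I else -Complex.I) * T v a)

lemma norm_sq_comp_perm {ι : Type*} [DecidableEq ι] {k : ℕ} (γ : (ι → ℂ) [⋀^Fin k]→ₗ[ℂ] ℂ)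
    (g : Fin k → ι) (σ : Equiv.Perm (Fin k)) : ‖comp γ (g ∘ σ)‖ ^ 2 = ‖comp γ g‖ ^ 2 := by
  rw [comp_perm, Units.smul_def, zsmul_eq_mul, norm_mul, mul_pow]
  rcases Int.units_eq_one_or (Equiv.Perm.sign σ) with h | h <;> simp [h]

include hT hV

lemma norm_sq_pullback_top (γ : (Fin 4 ⊕ Fin 4 → ℂ) [⋀^Fin 8]→ₗ[ℂ] ℂ) :
    ‖pullback T γ‖ ^ 2 = ‖comp γ topIndex‖ ^ 2 := by
  have hinj : Function.Injective topIndex := by decide +kernel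
  rw [norm_sq_pullback (unitary_of_isometry hT (by simp [hV])),
    sum_eq_factorial_mul_sum (κ := Unit) (G := fun _ => topIndex) (norm_sq_comp_perm γ)
      (fun _ => hinj) (fun _ _ _ => rfl) fun g hg => ?_]
  · rw [Fintype.sum_unique, inv_mul_cancel_left₀ (by positivity)]
  -- A component with a repeated index vanishes; eight distinct indices exhaust the index set.
  · have hg' : Function.Injective g := by
      by_contra h
      exact hg (by rw [comp_eq_zero γ h]; simp)
    have hu {f : Fin 8 → Fin 4 ⊕ Fin 4} (hf : Function.Injective f) :
        Finset.univ.image f = Finset.univ := by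
      rw [← Finset.card_eq_iff_eq_univ, Finset.card_image_of_injective _ hf]
      simp
    exact ⟨hg', (), (hu hinj).trans (hu hg').symm⟩

include hJ

lemma norm_sq_bracketProj_six (γ : (Fin 4 ⊕ Fin 4 → ℂ) [⋀^Fin 6]→ₗ[ℂ] ℂ) :
    ‖bracketProj J 4 2 (pullback T γ)‖ ^ 2 = ∑ i, ‖comp γ (sixIndex i)‖ ^ 2 := by
  rw [norm_sq_bracketProj_pullback hT (by simp [hV]) Sum.isLeft hJ (by norm_num),
    sum_eq_factorial_mul_sum (G := sixIndex) ?_ sixIndex_injective image_sixIndex_injective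
      fun g hg => ?_]
  · rw [inv_mul_cancel_left₀ (by positivity)]
    refine Finset.sum_congr rfl fun i _ => if_pos ?_
    revert i
    decide +kernel
  · intro g σ
    rw [norm_sq_comp_perm, typeCount_perm Sum.isLeft (g ∘ σ) g σ fun i => rfl]
  · have hg' : Function.Injective g := by
      by_contra h
      exact hg (by rw [comp_eq_zero γ h]; simp)
    refine ⟨hg', exists_image_sixIndex _ (by rw [Finset.card_image_of_injective _ hg']; simp) ?_⟩
    rw [← typeCount_eq_card_filter_image _ hg']
    by_contra h
    exact hg (if_neg h)

lemma norm_sq_bracketProj_four (γ : (Fin 4 ⊕ Fin 4 → ℂ) [⋀^Fin 4]→ₗ[ℂ] ℂ) :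
    ‖bracketProj J 4 0 (pullback T γ)‖ ^ 2 = ∑ i, ‖comp γ (fourIndex i)‖ ^ 2 := by
  rw [norm_sq_bracketProj_pullback hT (by simp [hV]) Sum.isLeft hJ (by norm_num),
    sum_eq_factorial_mul_sum (G := fourIndex) ?_ (by decide +kernel) (by decide +kernel)
      fun g hg => ?_]
  · rw [inv_mul_cancel_left₀ (by positivity)]
    refine Finset.sum_congr rfl fun i _ => if_pos ?_
    revert i
    decide +kernel
  · intro g σ
    rw [norm_sq_comp_perm, typeCount_perm Sum.isLeft (g ∘ σ) g σ fun i => rfl]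
  · have hg' : Function.Injective g := by
      by_contra h
      exact hg (by rw [comp_eq_zero γ h]; simp)
    refine ⟨hg', exists_image_fourIndex _ (by rw [Finset.card_image_of_injective _ hg']; simp) ?_⟩
    rw [← typeCount_eq_card_filter_image _ hg']
    by_contra h
    exact hg (if_neg h)

lemma bracketProj_two_eq_zero_iff (γ : (Fin 4 ⊕ Fin 4 → ℂ) [⋀^Fin 2]→ₗ[ℂ] ℂ) :
    bracketProj J 2 0 (pullback T γ) = 0 ↔
      ∀ j k, comp γ ![inl j, inl k] = 0 ∧ comp γ ![inr j, inr k] = 0 := by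
  rw [← norm_eq_zero, ← sq_eq_zero_iff, norm_sq_bracketProj_pullback hT (by simp [hV]) Sum.isLeft
    hJ (by norm_num), mul_eq_zero_iff_left (by positivity),
    Finset.sum_eq_zero_iff_of_nonneg fun g _ => by positivity]
  have hc (a b : Fin 4 ⊕ Fin 4) : typeCount Sum.isLeft ![a, b] =
      (if a.isLeft then 1 else 0) + if b.isLeft then 1 else 0 := by
    rw [typeCount, Finset.card_filter, Fin.sum_univ_two]; rfl
  constructor
  · intro h j k
    have h1 := h ![inl j, inl k] (Finset.mem_univ _)
    have h2 := h ![inr j, inr k] (Finset.mem_univ _)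
    rw [hc] at h1 h2
    simpa using And.intro h1 h2
  · intro h g _
    have hg : g = ![g 0, g 1] := by ext i; fin_cases i <;> rfl
    rw [hg, hc]
    rcases g 0 with j | j <;> rcases g 1 with k | k <;> simp [h j k]

end CForm
end Families

/-! ### The determinant as a quadratic expression in Pfaffians -/

section Determinant

open Matrix Sum

/-- The skew-symmetric `4 × 4` matrix with the given entries above the diagonal. -/
def skewFour (a b c d e f : ℂ) : Matrix (Fin 4) (Fin 4) ℂ :=
  !![0, a, b, c; -a, 0, d, e; -b, -d, 0, f; -c, -e, -f, 0]

/-- The skew-symmetric matrix of a `2`-form whose `(1, 1)`-part is diagonal. -/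
def blockSkew (p : Fin 4 → ℂ) (n n' : Matrix (Fin 4) (Fin 4) ℂ) :
    Fin 4 ⊕ Fin 4 → Fin 4 ⊕ Fin 4 → ℂ
  | inl j, inl k => -n' j k
  | inr j, inr k => -n j k
  | inl j, inr k => if j = k then p j else 0
  | inr j, inl k => if j = k then -p j else 0

/-- The Pfaffian of the `6 × 6` submatrix with the given indices. -/
def pfaffianSixAt (m : Fin 4 ⊕ Fin 4 → Fin 4 ⊕ Fin 4 → ℂ) (g : Fin 6 → Fin 4 ⊕ Fin 4) : ℂ :=
  pfaffianSix m (g 0) (g 1) (g 2) (g 3) (g 4) (g 5)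

/-- The Pfaffian of the `4 × 4` submatrix with the given indices. -/
def pfaffianFourAt (m : Fin 4 ⊕ Fin 4 → Fin 4 ⊕ Fin 4 → ℂ) (g : Fin 4 → Fin 4 ⊕ Fin 4) : ℂ :=
  pfaffianFour m (g 0) (g 1) (g 2) (g 3)

/-- The Pfaffian of the whole matrix. -/
def pfaffianTop (m : Fin 4 ⊕ Fin 4 → Fin 4 ⊕ Fin 4 → ℂ) : ℂ :=
  pfaffianEight m (topIndex 0) (topIndex 1) (topIndex 2) (topIndex 3) (topIndex 4) (topIndex 5)
    (topIndex 6) (topIndex 7)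

lemma det_four (x : Matrix (Fin 4) (Fin 4) ℂ) : x.det =
    (x 0 0 * x 1 1 - x 0 1 * x 1 0) * (x 2 2 * x 3 3 - x 2 3 * x 3 2)
    - (x 0 0 * x 1 2 - x 0 2 * x 1 0) * (x 2 1 * x 3 3 - x 2 3 * x 3 1)
    + (x 0 0 * x 1 3 - x 0 3 * x 1 0) * (x 2 1 * x 3 2 - x 2 2 * x 3 1)
    + (x 0 1 * x 1 2 - x 0 2 * x 1 1) * (x 2 0 * x 3 3 - x 2 3 * x 3 0)
    - (x 0 1 * x 1 3 - x 0 3 * x 1 1) * (x 2 0 * x 3 2 - x 2 2 * x 3 0)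
    + (x 0 2 * x 1 3 - x 0 3 * x 1 2) * (x 2 0 * x 3 1 - x 2 1 * x 3 0) := by
  simp [Matrix.det_succ_row_zero, Fin.sum_univ_succ, Fin.succAbove]
  ring

lemma det_fromBlocks_aux (r q : Fin 4 → ℂ) (a b c d e f a' b' c' d' e' f' : ℂ) :
    (diagonal q - skewFour a' b' c' d' e' f' * diagonal r * skewFour a b c d e f) =
    !![q 0 + a' * r 1 * a + b' * r 2 * b + c' * r 3 * c, b' * r 2 * d + c' * r 3 * e,
        -(a' * r 1 * d) + c' * r 3 * f, -(a' * r 1 * e) - b' * r 2 * f;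
      d' * r 2 * b + e' * r 3 * c, q 1 + a' * r 0 * a + d' * r 2 * d + e' * r 3 * e,
        a' * r 0 * b + e' * r 3 * f, a' * r 0 * c - d' * r 2 * f;
      -(d' * r 1 * a) + f' * r 3 * c, b' * r 0 * a + f' * r 3 * e,
        q 2 + b' * r 0 * b + d' * r 1 * d + f' * r 3 * f, b' * r 0 * c + d' * r 1 * e;
      -(e' * r 1 * a) - f' * r 2 * b, c' * r 0 * a - f' * r 2 * d,
        c' * r 0 * b + e' * r 1 * d, q 3 + c' * r 0 * c + e' * r 1 * e + f' * r 2 * f] := by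
  ext i j
  rw [Matrix.sub_apply, Matrix.mul_apply, Fin.sum_univ_four]
  simp only [Matrix.mul_diagonal]
  fin_cases i <;> fin_cases j <;> simp [skewFour] <;> ring

-- The nonvanishing of `p` allows a Schur complement with respect to the diagonal block `p`, which
-- reduces the determinant to size 4. Once the denominators are cleared there remains a polynomial
-- identity in the p_i and the twelve entries. The relation q = 2 - p is what produces the weights:
-- with only `a` and `a'` present, the determinant exceeds the product of the top Pfaffians by a a'
-- (p_0 + q_0)(p_1 + q_1) p_2 p_3 q_2 q_3, in which the two sums multiply to 4, twice the number of
-- contributing six-index terms.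
set_option maxHeartbeats 4000000 in
lemma det_fromBlocks_skewFour (p q : Fin 4 → ℂ) (hp : ∀ i, p i ≠ 0) (hpq : ∀ i, q i = 2 - p i)
    (a b c d e f a' b' c' d' e' f' : ℂ) :
    (fromBlocks (diagonal p) (skewFour a b c d e f) (skewFour a' b' c' d' e' f')
      (diagonal q)).det =
      pfaffianTop (blockSkew p (skewFour a b c d e f) (skewFour a' b' c' d' e' f')) *
        pfaffianTop (blockSkew q (skewFour a' b' c' d' e' f') (skewFour a b c d e f)) +
      2 * ∑ i, pfaffianSixAt (blockSkew p (skewFour a b c d e f) (skewFour a' b' c' d' e' f'))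
          (sixIndex i) *
        pfaffianSixAt (blockSkew q (skewFour a' b' c' d' e' f') (skewFour a b c d e f))
          (sixIndex i) +
      8 * ∑ i, pfaffianFourAt (blockSkew p (skewFour a b c d e f) (skewFour a' b' c' d' e' f'))
          (fourIndex i) *
        pfaffianFourAt (blockSkew q (skewFour a' b' c' d' e' f') (skewFour a b c d e f))
          (fourIndex i) := by
  let : Invertible p :=
    ⟨fun i => (p i)⁻¹, funext fun i => inv_mul_cancel₀ (hp i),
      funext fun i => mul_inv_cancel₀ (hp i)⟩
  have h0 := hp 0
  have h1 := hp 1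
  have h2 := hp 2
  have h3 := hp 3
  let := diagonalInvertible p
  have hi : ⅟ (diagonal p) = diagonal fun i => (p i)⁻¹ := by
    rw [invOf_diagonal_eq]; rfl
  rw [det_fromBlocks₁₁, hi, det_diagonal]
  rw [det_fromBlocks_aux, det_four, Fin.prod_univ_four, Fintype.sum_prod_type]
  simp only [Fin.sum_univ_six, Fintype.sum_bool, pfaffianTop, pfaffianSixAt, pfaffianFourAt,
    pfaffianEight, pfaffianSix, pfaffianFour, topIndex, sixIndex, fourIndex]
  simp [blockSkew, skewFour, hpq]
  generalize p 0 = p0 at *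
  generalize p 1 = p1 at *
  generalize p 2 = p2 at *
  generalize p 3 = p3 at *
  field_simp
  ring

end Determinant

/-! ### Unitary coordinates adapted to a skew operator -/

section UnitaryCoordinates

variable {V : Type*} [NormedAddCommGroup V] [InnerProductSpace ℝ V] [FiniteDimensional ℝ V]

open Sum (inl inr)

/-- In suitable unitary coordinates `(z, z̄) / √2`, the complex linear part of a skew-symmetric
operator is diagonal. -/
lemma exists_unitary_coordinates {J K : V →ₗ[ℝ] V} (hJ2 : ∀ v, J (J v) = -v)
    (hJ : ∀ u v, inner ℝ (J u) (J v) = inner ℝ u v)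
    (hK : ∀ u v, inner ℝ (K u) v = -(inner ℝ u (K v) : ℝ)) {m : ℕ} (hV : finrank ℝ V = 2 * m) :
    ∃ (T : V →ₗ[ℝ] (Fin m ⊕ Fin m → ℂ)) (s : Fin m → ℝ) (n : Matrix (Fin m) (Fin m) ℂ),
      (∀ u v, ∑ a, starRingEnd ℂ (T u a) * T v a = (inner ℝ u v : ℝ)) ∧
      (∀ v a, T (J v) a = (if a.isLeft then Complex.I else -Complex.I) * T v a) ∧
      (∀ v j, T v (inr j) = starRingEnd ℂ (T v (inl j))) ∧
      (∀ j k, n j k = -n k j) ∧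
      ∀ v j, T (K v) (inl j) = Complex.I * s j * T v (inl j) + ∑ k, n j k * T v (inr k) := by
  have hskew (u v : V) : inner ℝ (J u) v = -(inner ℝ u (J v) : ℝ) := by
    have := hJ u (J v)
    rw [hJ2, inner_neg_right] at this
    linarith
  -- Chosen so that -JS = (K - JKJ)/2 is the part of `K` commuting with `J`.
  let S : V →ₗ[ℝ] V := (2⁻¹ : ℝ) • (J ∘ₗ K + K ∘ₗ J)
  have hSapp (v : V) : S v = (2⁻¹ : ℝ) • (J (K v) + K (J v)) := rfl
  have hS : S.IsSymmetric := by
    intro u v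
    rw [hSapp, hSapp, real_inner_smul_left, real_inner_smul_right, inner_add_left, inner_add_right,
      hskew, hK, hK, hskew]
    ring
  have hSJ (v : V) : S (J v) = J (S v) := by
    rw [hSapp, hSapp, map_smul, map_add, hJ2, hJ2, map_neg, add_comm]
  obtain ⟨e, h, he, heJ, hSe⟩ := exists_unitary_eigenframe hJ2 hJ hS hSJ hV m le_rfl
  have hon : Orthonormal ℝ (Sum.elim e fun j => J (e j)) := by
    rw [orthonormal_iff_ite]
    rintro (i | i) (j | j)
    · simpa using he i j
    · simpa using heJ i j
    · simpa [real_inner_comm] using heJ j i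
    · simpa [hJ] using he i j
  let b : OrthonormalBasis (Fin m ⊕ Fin m) ℝ V := OrthonormalBasis.mk hon (by
    rw [hon.linearIndependent.span_eq_top_of_card_eq_finrank' (by simp [hV, two_mul])])
  have hbl (j : Fin m) : b (inl j) = e j := by simp [b]
  have hbr (j : Fin m) : b (inr j) = J (e j) := by simp [b]
  let dz (j : Fin m) (v : V) : ℂ :=
    ((inner ℝ (e j) v : ℝ) : ℂ) + Complex.I * ((inner ℝ (J (e j)) v : ℝ) : ℂ)
  -- Each real inner product is split evenly between the dz_j and their conjugates; the factor 1/√2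
  -- makes `T` an isometry.
  let r : ℝ := (√2)⁻¹
  have hr : (r : ℂ) * r = 2⁻¹ := by
    have : r * r = 2⁻¹ := by
      simp only [r]
      rw [← mul_inv, Real.mul_self_sqrt zero_le_two]
    rw [← Complex.ofReal_mul, this]
    simp
  let T : V →ₗ[ℝ] (Fin m ⊕ Fin m → ℂ) :=
    { toFun := fun v => Sum.elim (fun j => r * dz j v) fun j => r * starRingEnd ℂ (dz j v)
      map_add' := fun u v => by
        ext (j | j) <;> simp [dz, inner_add_right] <;> ring
      map_smul' := fun c v => by
        ext (j | j) <;> simp [dz, real_inner_smul_right] <;> ring }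
  have hTl (v : V) (j : Fin m) : T v (inl j) = r * dz j v := rfl
  have hTr (v : V) (j : Fin m) : T v (inr j) = r * starRingEnd ℂ (dz j v) := rfl
  have hdzJ (v : V) (j : Fin m) : dz j (J v) = Complex.I * dz j v := by
    have h1 : inner ℝ (e j) (J v) = -(inner ℝ (J (e j)) v : ℝ) := by rw [hskew]; ring
    simp only [dz, h1, hJ]
    push_cast
    linear_combination -((inner ℝ (J (e j)) v : ℝ) : ℂ) * Complex.I_mul_I
  let K₂ : V →ₗ[ℝ] V := K + J ∘ₗ S
  have hK₂app (v : V) : K₂ v = K v + J (S v) := rfl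
  have hK₂J (v : V) : K₂ (J v) = -J (K₂ v) := by
    rw [hK₂app, hK₂app, hSJ, hJ2, map_add, hJ2, hSapp]
    module
  have hK₂ (u v : V) : inner ℝ (K₂ u) v = -(inner ℝ u (K₂ v) : ℝ) := by
    rw [hK₂app, hK₂app, inner_add_left, inner_add_right, hK, hskew, hS, hSJ]
    ring
  let n : Matrix (Fin m) (Fin m) ℂ := Matrix.of fun j k => dz j (K₂ (e k))
  refine ⟨T, fun j => -h j, n, ?_, ?_, ?_, ?_, ?_⟩
  · intro u v
    rw [← b.sum_inner_mul_inner u v, Fintype.sum_sum_type, Fintype.sum_sum_type,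
      ← Finset.sum_add_distrib, ← Finset.sum_add_distrib, Complex.ofReal_sum]
    refine Finset.sum_congr rfl fun j _ => ?_
    rw [hbl, hbr, real_inner_comm (e j) u, real_inner_comm (J (e j)) u]
    simp only [hTl, hTr, dz, map_mul, map_add, Complex.conj_ofReal, Complex.conj_I, map_neg,
      neg_neg]
    push_cast
    linear_combination (2 * ((inner ℝ (e j) u : ℝ) : ℂ) * ((inner ℝ (e j) v : ℝ) : ℂ)
      - 2 * Complex.I * Complex.I * ((inner ℝ (J (e j)) u : ℝ) : ℂ) *
        ((inner ℝ (J (e j)) v : ℝ) : ℂ)) * hr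
      - ((inner ℝ (J (e j)) u : ℝ) : ℂ) * ((inner ℝ (J (e j)) v : ℝ) : ℂ) * Complex.I_mul_I
  · rintro v (j | j)
    · rw [hTl, hTl, hdzJ]
      simp; ring
    · rw [hTr, hTr, hdzJ]
      simp; ring
  · intro v j
    rw [hTl, hTr, map_mul, Complex.conj_ofReal]
  · intro j k
    have h1 : inner ℝ (e j) (K₂ (e k)) = -(inner ℝ (e k) (K₂ (e j)) : ℝ) := by
      rw [← hK₂, real_inner_comm]
    have h2 : inner ℝ (J (e j)) (K₂ (e k)) = -(inner ℝ (J (e k)) (K₂ (e j)) : ℝ) := by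
      have h3 := hK₂ (J (e j)) (e k)
      rw [hK₂J, inner_neg_left, hskew, real_inner_comm] at h3
      linarith
    change dz j (K₂ (e k)) = -dz k (K₂ (e j))
    simp only [dz, h1, h2]
    push_cast; ring
  · intro v j
    have h1 : dz j (K v) = -(Complex.I * h j * dz j v) + dz j (K₂ v) := by
      have h2 : inner ℝ (e j) (J (S v)) = -(h j * inner ℝ (J (e j)) v : ℝ) := by
        have := hskew (e j) (S v)
        rw [← hS, hSJ, hSe, map_smul, real_inner_smul_left] at this
        linarith
      have h3 : inner ℝ (J (e j)) (J (S v)) = (h j * inner ℝ (e j) v : ℝ) := by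
        rw [hJ, ← hS, hSe, real_inner_smul_left]
      simp only [dz, hK₂app, inner_add_right, h2, h3]
      push_cast
      linear_combination ((h j : ℂ) * ((inner ℝ (J (e j)) v : ℝ) : ℂ)) * Complex.I_mul_I
    have hdz_add (u w : V) : dz j (u + w) = dz j u + dz j w := by
      simp only [dz, inner_add_right]; push_cast; ring
    let D : V →ₗ[ℝ] ℂ :=
      { toFun := fun v => dz j v
        map_add' := hdz_add
        map_smul' := fun c v => by
          simp only [dz, real_inner_smul_right, RingHom.id_apply, Complex.real_smul]
          push_cast; ring }
    -- Since `K₂` anticommutes with `J`, dz_j ∘ K₂ is conjugate linear, hence determined by its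
    -- values on the e_k.
    have h4 : dz j (K₂ v) = ∑ k, n j k * starRingEnd ℂ (dz k v) := by
      change (D ∘ₗ K₂) v = _
      conv_lhs => rw [← b.sum_repr' v, map_sum, Fintype.sum_sum_type]
      rw [← Finset.sum_add_distrib]
      refine Finset.sum_congr rfl fun k _ => ?_
      rw [hbl, hbr, map_smul, map_smul]
      have h5 : (D ∘ₗ K₂) (e k) = n j k := rfl
      have h6 : (D ∘ₗ K₂) (J (e k)) = -(Complex.I * n j k) := by
        change D (K₂ (J (e k))) = _
        rw [hK₂J, map_neg]
        exact congrArg Neg.neg (hdzJ _ _)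
      rw [h5, h6, Complex.real_smul, Complex.real_smul]
      simp only [dz, map_add, map_mul, Complex.conj_ofReal, Complex.conj_I]
      ring
    simp only [hTl, hTr, h1, h4]
    rw [mul_add, Finset.mul_sum]
    congr 1
    · push_cast; ring
    · exact Finset.sum_congr rfl fun k _ => by ring

end UnitaryCoordinates

/-! ### Components of powers of a 2-form with a given matrix -/

section Pointwise

open Sum (inl inr)

lemma pfaffianFour_comp {ι κ : Type*} (m : κ → κ → ℂ) (f : ι → κ) (i j k l : ι) :
    pfaffianFour (fun a b => m (f a) (f b)) i j k l = pfaffianFour m (f i) (f j) (f k) (f l) :=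
  rfl

lemma pfaffianSix_comp {ι κ : Type*} (m : κ → κ → ℂ) (f : ι → κ) (i j k l u v : ι) :
    pfaffianSix (fun a b => m (f a) (f b)) i j k l u v =
      pfaffianSix m (f i) (f j) (f k) (f l) (f u) (f v) := by
  simp only [pfaffianSix, pfaffianFour_comp]

lemma pfaffianEight_comp {ι κ : Type*} (m : κ → κ → ℂ) (f : ι → κ) (i j k l u v x y : ι) :
    pfaffianEight (fun a b => m (f a) (f b)) i j k l u v x y =
      pfaffianEight m (f i) (f j) (f k) (f l) (f u) (f v) (f x) (f y) := by
  simp only [pfaffianEight, pfaffianSix_comp]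

namespace CForm

section MatrixForm

variable {ι : Type*} [Fintype ι]

/-- The complex `2`-form with a given skew-symmetric matrix. -/
def matrixForm (m : ι → ι → ℂ) : (ι → ℂ) [⋀^Fin 2]→ₗ[ℂ] ℂ :=
  (2⁻¹ : ℂ) • ∑ x : ι × ι, m x.1 x.2 • detForm ![x.1, x.2]

lemma matrixForm_apply {m : ι → ι → ℂ} (hm : ∀ a b, m a b = -m b a) (w : Fin 2 → ι → ℂ) :
    matrixForm m w = ∑ a, ∑ b, m a b * (w 0 a * w 1 b) := by
  have h1 : matrixForm m w = 2⁻¹ * ∑ a, ∑ b, m a b * (w 0 a * w 1 b - w 0 b * w 1 a) := by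
    rw [matrixForm, AlternatingMap.smul_apply, alternatingMap_sum_apply, Fintype.sum_prod_type,
      smul_eq_mul]
    simp only [AlternatingMap.smul_apply, detForm_apply, Matrix.det_fin_two, smul_eq_mul]
    rfl
  have h2 : ∑ a, ∑ b, m a b * (w 0 b * w 1 a) = -∑ a, ∑ b, m a b * (w 0 a * w 1 b) := by
    rw [Finset.sum_comm, ← Finset.sum_neg_distrib]
    refine Finset.sum_congr rfl fun a _ => ?_
    rw [← Finset.sum_neg_distrib]
    refine Finset.sum_congr rfl fun b _ => ?_
    rw [hm b a]; ring
  simp only [mul_sub, Finset.sum_sub_distrib, h2] at h1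
  rw [h1]; ring

variable [DecidableEq ι]

lemma comp_matrixForm {m : ι → ι → ℂ} (hm : ∀ a b, m a b = -m b a) (a b : ι) :
    comp (matrixForm m) ![a, b] = m a b := by
  rw [comp, matrixForm_apply hm]
  simp [Pi.single_apply]

omit [Fintype ι] in
lemma comp_vec_two (γ : (ι → ℂ) [⋀^Fin 2]→ₗ[ℂ] ℂ) (a b : ι) :
    γ ![Pi.single a 1, Pi.single b 1] = comp γ ![a, b] := by
  rw [comp]
  congr 1
  ext i : 1
  fin_cases i <;> rfl

omit [Fintype ι] in
lemma comp_cpow_two (γ : (ι → ℂ) [⋀^Fin 2]→ₗ[ℂ] ℂ) (g : Fin 4 → ι) :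
    comp (γ.cpow 2) g = 2 * pfaffianFour (fun a b => comp γ ![a, b]) (g 0) (g 1) (g 2) (g 3) := by
  simp only [← comp_vec_two, pfaffianFour_comp (fun x y => γ ![x, y]) fun a => Pi.single a 1]
  exact AlternatingMap.cpow_two_apply γ fun i => Pi.single (g i) 1

omit [Fintype ι] in
lemma comp_cpow_three (γ : (ι → ℂ) [⋀^Fin 2]→ₗ[ℂ] ℂ) (g : Fin 6 → ι) :
    comp (γ.cpow 3) g = 6 * pfaffianSix (fun a b => comp γ ![a, b])
      (g 0) (g 1) (g 2) (g 3) (g 4) (g 5) := by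
  simp only [← comp_vec_two, pfaffianSix_comp (fun x y => γ ![x, y]) fun a => Pi.single a 1]
  have h (v : Fin 6 → ι → ℂ) := AlternatingMap.cpow_three_apply γ v
  rw [comp]
  refine (h _).trans ?_
  rfl

omit [Fintype ι] in
lemma comp_cpow_four (γ : (ι → ℂ) [⋀^Fin 2]→ₗ[ℂ] ℂ) (g : Fin 8 → ι) :
    comp (γ.cpow 4) g = 24 * pfaffianEight (fun a b => comp γ ![a, b])
      (g 0) (g 1) (g 2) (g 3) (g 4) (g 5) (g 6) (g 7) := by
  simp only [← comp_vec_two, pfaffianEight_comp (fun x y => γ ![x, y]) fun a => Pi.single a 1]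
  have h (v : Fin 8 → ι → ℂ) := AlternatingMap.cpow_four_apply γ v
  rw [comp]
  refine (h _).trans ?_
  rfl

end MatrixForm

end CForm

lemma pfaffianFour_smul {ι : Type*} (c : ℂ) (m : ι → ι → ℂ) (i j k l : ι) :
    pfaffianFour (fun a b => c * m a b) i j k l = c ^ 2 * pfaffianFour m i j k l := by
  unfold pfaffianFour; ring

lemma pfaffianSix_smul {ι : Type*} (c : ℂ) (m : ι → ι → ℂ) (i j k l u v : ι) :
    pfaffianSix (fun a b => c * m a b) i j k l u v = c ^ 3 * pfaffianSix m i j k l u v := by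
  unfold pfaffianSix; simp only [pfaffianFour_smul]; ring

lemma pfaffianEight_smul {ι : Type*} (c : ℂ) (m : ι → ι → ℂ) (i j k l u v x y : ι) :
    pfaffianEight (fun a b => c * m a b) i j k l u v x y =
      c ^ 4 * pfaffianEight m i j k l u v x y := by
  unfold pfaffianEight; simp only [pfaffianSix_smul]; ring

lemma conj_pfaffianFour {ι : Type*} (m : ι → ι → ℂ) (i j k l : ι) :
    starRingEnd ℂ (pfaffianFour m i j k l) =
      pfaffianFour (fun a b => starRingEnd ℂ (m a b)) i j k l := by
  simp [pfaffianFour]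

lemma conj_pfaffianSix {ι : Type*} (m : ι → ι → ℂ) (i j k l u v : ι) :
    starRingEnd ℂ (pfaffianSix m i j k l u v) =
      pfaffianSix (fun a b => starRingEnd ℂ (m a b)) i j k l u v := by
  simp [pfaffianSix, conj_pfaffianFour]

lemma conj_pfaffianEight {ι : Type*} (m : ι → ι → ℂ) (i j k l u v x y : ι) :
    starRingEnd ℂ (pfaffianEight m i j k l u v x y) =
      pfaffianEight (fun a b => starRingEnd ℂ (m a b)) i j k l u v x y := by
  simp [pfaffianEight, conj_pfaffianSix]

/-- Conjugation exchanges p with q and n with n', so the products of Pfaffians in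
`det_fromBlocks_skewFour` are squared moduli. -/
lemma conj_blockSkew {p q : Fin 4 → ℂ} (hpq : ∀ i, starRingEnd ℂ (p i) = q i)
    {n n' : Matrix (Fin 4) (Fin 4) ℂ} (hn : ∀ j k, starRingEnd ℂ (n j k) = n' j k) :
    (fun a b => starRingEnd ℂ (blockSkew p n n' a b)) = blockSkew q n' n := by
  have hn' (j k) : starRingEnd ℂ (n' j k) = n j k := by rw [← hn, Complex.conj_conj]
  ext (a | a) (b | b)
  · simp [blockSkew, hn']
  · simp only [blockSkew]; split_ifs <;> simp [hpq]
  · simp only [blockSkew]; split_ifs <;> simp [hpq]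
  · simp [blockSkew, hn]

lemma blockSkew_skew (p : Fin 4 → ℂ) {n n' : Matrix (Fin 4) (Fin 4) ℂ}
    (hn : ∀ j k, n j k = -n k j) (hn' : ∀ j k, n' j k = -n' k j) (a b : Fin 4 ⊕ Fin 4) :
    blockSkew p n n' a b = -blockSkew p n n' b a := by
  rcases a with a | a <;> rcases b with b | b
  · simp only [blockSkew]; rw [hn']
  · simp only [blockSkew, eq_comm (a := b)]
    split_ifs with h
    · rw [h, neg_neg]
    · simp
  · simp only [blockSkew, eq_comm (a := b)]
    split_ifs with h
    · rw [h]
    · simp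
  · simp only [blockSkew]; rw [hn]

lemma eq_skewFour {n : Matrix (Fin 4) (Fin 4) ℂ} (hn : ∀ j k, n j k = -n k j) :
    n = skewFour (n 0 1) (n 0 2) (n 0 3) (n 1 2) (n 1 3) (n 2 3) := by
  have hd (j) : n j j = 0 := self_eq_neg.1 (hn j j)
  ext j k
  fin_cases j <;> fin_cases k <;>
    simp [skewFour, hd, hn 1 0, hn 2 0, hn 3 0, hn 2 1, hn 3 1, hn 3 2]

/-- If the Pfaffians of the blocks of types `(4, 2)` and `(4, 0)` vanish, so does the
off-diagonal part. -/
lemma skewFour_eq_zero {p : Fin 4 → ℂ} (hp : ∀ i, p i ≠ 0) {a b c d e f a' b' c' d' e' f' : ℂ}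
    (h6 : ∀ i, pfaffianSixAt (blockSkew p (skewFour a b c d e f) (skewFour a' b' c' d' e' f'))
      (sixIndex i) = 0)
    (h4 : ∀ i, pfaffianFourAt (blockSkew p (skewFour a b c d e f) (skewFour a' b' c' d' e' f'))
      (fourIndex i) = 0) : a = 0 ∧ b = 0 ∧ c = 0 ∧ d = 0 ∧ e = 0 ∧ f = 0 := by
  have h0 := h4 false
  have h i := h6 (i, false)
  have e0 := h 0
  have e1 := h 1
  have e2 := h 2
  have e3 := h 3
  have e4 := h 4
  have e5 := h 5
  simp [pfaffianFourAt, pfaffianSixAt, pfaffianFour, pfaffianSix, blockSkew, skewFour, fourIndex,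
    sixIndex] at h0 e0 e1 e2 e3 e4 e5
  -- `h0` is Pf(n) = 0. It removes the term n'_jk Pf(n) from the Pfaffian on {j, k} and all barred
  -- indices, which leaves ±p_j p_k times the entry of n at the two complementary indices.
  simp only [h0, mul_zero, neg_zero, zero_add, zero_sub, neg_eq_zero, mul_eq_zero, hp,
    false_or] at e0 e1 e2 e3 e4 e5
  exact ⟨e5, e4, e3, e2, e1, e0⟩

end Pointwise

/-! ### The operator id + K and the form ω + F in unitary coordinates -/

section PointwiseIdentity

open Sum (inl inr)

namespace CForm

variable {V : Type*} [NormedAddCommGroup V] [InnerProductSpace ℝ V] [FiniteDimensional ℝ V]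

/-- The values of `T` on an orthonormal basis form an invertible matrix, which conjugates the real
matrix of `K` into `M`. -/
lemma det_eq_of_coordinates {ι : Type*} [Fintype ι] [DecidableEq ι] {T : V →ₗ[ℝ] (ι → ℂ)}
    (hT : ∀ u v, ∑ a, starRingEnd ℂ (T u a) * T v a = (inner ℝ u v : ℝ))
    (hι : Fintype.card ι = finrank ℝ V) {K : V →ₗ[ℝ] V} {M : Matrix ι ι ℂ}
    (hM : ∀ v a, T (K v) a = ∑ b, M a b * T v b) : ((LinearMap.det K : ℝ) : ℂ) = M.det := by
  let e := stdOrthonormalBasis ℝ V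
  let R := LinearMap.toMatrix e.toBasis e.toBasis K
  let A : Matrix (Fin (finrank ℝ V)) ι ℂ := Matrix.of fun i a => starRingEnd ℂ (T (e i) a)
  let B : Matrix ι (Fin (finrank ℝ V)) ℂ := Matrix.of fun a i => T (e i) a
  have hAB : A * B = 1 := by
    ext i j
    rw [Matrix.mul_apply, Matrix.one_apply]
    refine (hT _ _).trans ?_
    rw [orthonormal_iff_ite.1 e.orthonormal]
    split_ifs <;> simp
  have hBA : B * A = 1 := (Matrix.mul_eq_one_comm_of_card_eq _ _ _ (by simp [hι])).1 hAB
  have hBR : B * R.map Complex.ofReal = M * B := by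
    ext a i
    rw [Matrix.mul_apply, Matrix.mul_apply]
    refine Eq.trans ?_ (hM (e i) a)
    have h : K (e i) = ∑ j, R j i • e j := by
      conv_lhs => rw [← e.sum_repr (K (e i))]
      refine Finset.sum_congr rfl fun j _ => ?_
      exact congrArg (· • e j) (by simp [R, LinearMap.toMatrix_apply])
    rw [h, map_sum, Finset.sum_apply]
    refine Finset.sum_congr rfl fun j _ => ?_
    rw [map_smul]
    simp [B, mul_comm]
  have hR : R.map Complex.ofReal = A * M * B := by
    rw [Matrix.mul_assoc, ← hBR, ← Matrix.mul_assoc, hAB, Matrix.one_mul]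
  have h1 : ((LinearMap.det K : ℝ) : ℂ) = (R.map Complex.ofReal).det := by
    rw [← LinearMap.det_toMatrix e.toBasis K]
    exact RingHom.map_det Complex.ofRealHom R
  rw [h1, hR, Matrix.mul_assoc, Matrix.det_comm' hAB hBA, Matrix.mul_assoc, hBA, Matrix.mul_one]

variable {J K : V →ₗ[ℝ] V} {T : V →ₗ[ℝ] (Fin 4 ⊕ Fin 4 → ℂ)} {s : Fin 4 → ℝ}
  {n n' : Matrix (Fin 4) (Fin 4) ℂ}
  (hT : ∀ u v, ∑ a, starRingEnd ℂ (T u a) * T v a = (inner ℝ u v : ℝ))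
  (hJ : ∀ v a, T (J v) a = (if a.isLeft then Complex.I else -Complex.I) * T v a)
  (hc : ∀ v j, T v (inr j) = starRingEnd ℂ (T v (inl j)))
  (hn : ∀ j k, n j k = -n k j) (hn' : ∀ j k, starRingEnd ℂ (n j k) = n' j k)
  (hK : ∀ v j, T (K v) (inl j) = Complex.I * s j * T v (inl j) + ∑ k, n j k * T v (inr k))

omit [FiniteDimensional ℝ V] in
include hc hn' hK in
lemma coordinates_right (v : V) (j : Fin 4) :
    T (K v) (inr j) = -Complex.I * s j * T v (inr j) + ∑ k, n' j k * T v (inl k) := by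
  rw [hc, hK]
  simp [hn', hc]

include hT hc hn' hK in
lemma det_id_add (hV : finrank ℝ V = 8) : ((LinearMap.det (LinearMap.id + K : V →ₗ[ℝ] V) : ℝ) : ℂ) =
    (Matrix.fromBlocks (Matrix.diagonal fun j => 1 + Complex.I * s j) n n'
      (Matrix.diagonal fun j => 1 - Complex.I * s j)).det := by
  refine det_eq_of_coordinates hT (by simp [hV]) fun v a => ?_
  rcases a with j | j
  · simp [hK, Matrix.diagonal_apply]
    ring
  · simp [coordinates_right hc hn' hK, Matrix.diagonal_apply]
    ring

omit [FiniteDimensional ℝ V] in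
include hT hJ hc hn hn' hK in
-- In these coordinates the metric pairs z_j with z̄_j, `J` contributes i and i·`K` contributes i ·
-- i s_j on the diagonal. The parameter `c` covers ω + F (c = 1) and F alone (c = 0).
lemma smul_add_eq_pullback {α F : CForm V 2} (hα : ∀ u v, α ![u, v] = (inner ℝ (J u) v : ℝ))
    (hF : ∀ u v, F ![u, v] = Complex.I * (inner ℝ (K u) v : ℝ)) (c : ℂ) :
    c • α + F = pullback T (matrixForm fun a b =>
      Complex.I * blockSkew (fun j => c + Complex.I * s j) n n' a b) := by
  have hns (j k) : n' j k = -n' k j := by rw [← hn', hn, map_neg, hn']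
  have hc' (v j) : starRingEnd ℂ (T v (inr j)) = T v (inl j) := by rw [hc, Complex.conj_conj]
  have h0 (x v : V) : ((inner ℝ x v : ℝ) : ℂ) =
      ∑ j, (T x (inr j) * T v (inl j) + T x (inl j) * T v (inr j)) := by
    rw [← hT, Fintype.sum_sum_type, Finset.sum_add_distrib]
    simp only [hc', ← hc]
  ext w
  have hw : w = ![w 0, w 1] := by ext i; fin_cases i <;> rfl
  rw [pullback_apply, matrixForm_apply fun a b => by rw [blockSkew_skew _ hn hns a b, mul_neg]]
  have h1 : (c • α + F) w = c * α ![w 0, w 1] + F ![w 0, w 1] := by rw [← hw]; rfl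
  rw [h1, hα, hF, h0, h0]
  simp only [hK, coordinates_right hc hn' hK, hJ]
  simp only [Fintype.sum_sum_type, blockSkew, ← hn, ← hns, Fin.sum_univ_four]
  simp
  ring

end CForm

end PointwiseIdentity

/-! ### The pointwise identity and the vanishing of the projections -/

section PointwiseIdentity

open Sum (inl inr)

lemma norm_sq_pfaffians {p q : Fin 4 → ℂ} (hpq : ∀ i, starRingEnd ℂ (p i) = q i)
    {n n' : Matrix (Fin 4) (Fin 4) ℂ} (hn : ∀ j k, starRingEnd ℂ (n j k) = n' j k) :
    ((‖pfaffianTop (blockSkew p n n')‖ ^ 2 : ℝ) : ℂ) =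
        pfaffianTop (blockSkew p n n') * pfaffianTop (blockSkew q n' n) ∧
      (∀ g, ((‖pfaffianSixAt (blockSkew p n n') g‖ ^ 2 : ℝ) : ℂ) =
        pfaffianSixAt (blockSkew p n n') g * pfaffianSixAt (blockSkew q n' n) g) ∧
      ∀ g, ((‖pfaffianFourAt (blockSkew p n n') g‖ ^ 2 : ℝ) : ℂ) =
        pfaffianFourAt (blockSkew p n n') g * pfaffianFourAt (blockSkew q n' n) g := by
  rw [← conj_blockSkew hpq hn]
  refine ⟨?_, fun g => ?_, fun g => ?_⟩
  · rw [Complex.ofReal_pow, ← Complex.mul_conj', pfaffianTop, conj_pfaffianEight]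
    rfl
  · rw [Complex.ofReal_pow, ← Complex.mul_conj', pfaffianSixAt, conj_pfaffianSix]
    rfl
  · rw [Complex.ofReal_pow, ← Complex.mul_conj', pfaffianFourAt, conj_pfaffianFour]
    rfl

namespace CForm

/-- The r-th power is r! times a Pfaffian; the factorial cancels, and the factor i^r taken out of
the matrix has modulus one. -/
lemma norm_comp_cpow {γ : (Fin 4 ⊕ Fin 4 → ℂ) [⋀^Fin 2]→ₗ[ℂ] ℂ}
    {m : Fin 4 ⊕ Fin 4 → Fin 4 ⊕ Fin 4 → ℂ} (hm : ∀ a b, comp γ ![a, b] = Complex.I * m a b) :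
    ‖comp ((Nat.factorial 4 : ℂ)⁻¹ • γ.cpow 4 : (Fin 4 ⊕ Fin 4 → ℂ) [⋀^Fin 8]→ₗ[ℂ] ℂ) topIndex‖ =
        ‖pfaffianTop m‖ ∧
      (∀ g, ‖comp ((Nat.factorial 3 : ℂ)⁻¹ • γ.cpow 3 : (Fin 4 ⊕ Fin 4 → ℂ) [⋀^Fin 6]→ₗ[ℂ] ℂ) g‖ =
        ‖pfaffianSixAt m g‖) ∧
      ∀ g, ‖comp ((Nat.factorial 2 : ℂ)⁻¹ • γ.cpow 2 : (Fin 4 ⊕ Fin 4 → ℂ) [⋀^Fin 4]→ₗ[ℂ] ℂ) g‖ =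
        ‖pfaffianFourAt m g‖ := by
  have hs {k : ℕ} (c : ℂ) (δ : (Fin 4 ⊕ Fin 4 → ℂ) [⋀^Fin k]→ₗ[ℂ] ℂ) (g) :
    comp (c • δ) g = c * comp δ g := rfl
  refine ⟨?_, fun g => ?_, fun g => ?_⟩
  · rw [hs, comp_cpow_four]
    simp only [hm, pfaffianEight_smul]
    simp [Nat.factorial, pfaffianTop]
  · rw [hs, comp_cpow_three]
    simp only [hm, pfaffianSix_smul]
    simp [Nat.factorial, pfaffianSixAt]
  · rw [hs, comp_cpow_two]
    simp only [hm, pfaffianFour_smul]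
    simp [Nat.factorial, pfaffianFourAt]

lemma sharp_skew {V : Type*} [NormedAddCommGroup V] [InnerProductSpace ℝ V]
    [FiniteDimensional ℝ V] (F : CForm V 2) (u v : V) :
    inner ℝ (sharp F u) v = -(inner ℝ u (sharp F v) : ℝ) := by
  rw [real_inner_comm (sharp F v) u, inner_sharp, inner_sharp, AlternatingMap.apply_vec_swap F u v]
  simp

/-- Linear algebra of a Kähler form `α` and of a `2`-form `F` with values in `iℝ`, on a Hermitian
vector space of complex dimension `4`. -/
theorem norm_sq_pow_add {V : Type*} [NormedAddCommGroup V] [InnerProductSpace ℝ V]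
    [FiniteDimensional ℝ V] (hV : finrank ℝ V = 8) {J : V →ₗ[ℝ] V} (hJ2 : ∀ v, J (J v) = -v)
    (hJ : ∀ u v, inner ℝ (J u) (J v) = inner ℝ u v) {α F : CForm V 2}
    (hα : ∀ u v, α ![u, v] = (inner ℝ (J u) v : ℝ)) (hF : ∀ u v, (F ![u, v]).re = 0) :
    ‖(Nat.factorial 4 : ℂ)⁻¹ • pow (α + F) 4‖ ^ 2
        + 2 * ‖bracketProj J 4 2 ((Nat.factorial 3 : ℂ)⁻¹ • pow (α + F) 3)‖ ^ 2
        + 8 * ‖bracketProj J 4 0 ((Nat.factorial 2 : ℂ)⁻¹ • pow (α + F) 2)‖ ^ 2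
        = LinearMap.det (LinearMap.id + sharp F) ∧
      ((bracketProj J 4 2 ((Nat.factorial 3 : ℂ)⁻¹ • pow (α + F) 3) = 0 ∧
        bracketProj J 4 0 ((Nat.factorial 2 : ℂ)⁻¹ • pow (α + F) 2) = 0) ↔
        bracketProj J 2 0 (-Complex.I • F) = 0) := by
  obtain ⟨T, s, n, hT, hTJ, hc, hn, hK⟩ :=
    exists_unitary_coordinates (m := 4) hJ2 hJ (sharp_skew F) hV
  have hFK (u v : V) : F ![u, v] = Complex.I * (inner ℝ (sharp F u) v : ℝ) := by
    rw [inner_sharp]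
    apply Complex.ext <;> simp [hF]
  obtain ⟨n', hn'⟩ : ∃ n' : Matrix (Fin 4) (Fin 4) ℂ, ∀ j k, starRingEnd ℂ (n j k) = n' j k :=
    ⟨n.map (starRingEnd ℂ), fun _ _ => rfl⟩
  have hns (j k) : n' j k = -n' k j := by rw [← hn', hn, map_neg, hn']
  have hform (c : ℂ) := smul_add_eq_pullback hT hTJ hc hn hn' hK hα hFK c
  set p : Fin 4 → ℂ := fun j => 1 + Complex.I * s j
  set q : Fin 4 → ℂ := fun j => 1 - Complex.I * s j
  have hpq (i) : starRingEnd ℂ (p i) = q i := by simp [p, q, sub_eq_add_neg]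
  have hp (i) : p i ≠ 0 := fun h => by simpa [p] using congrArg Complex.re h
  have hcomp (c : ℂ) (a b) := comp_matrixForm (m := fun a b =>
    Complex.I * blockSkew (fun j => c + Complex.I * s j) n n' a b)
    (fun a b => by rw [blockSkew_skew _ hn hns a b, mul_neg]) a b
  have h1 := hform 1
  rw [one_smul] at h1
  have h0 : -Complex.I • F = pullback T (-Complex.I • matrixForm fun a b =>
      Complex.I * blockSkew (fun j => 0 + Complex.I * s j) n n' a b) := by
    rw [pullback_smul, ← hform 0, zero_smul, zero_add]
  obtain ⟨n4, n3, n2⟩ := norm_comp_cpow (hcomp 1)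
  obtain ⟨m4, m3, m2⟩ := norm_sq_pfaffians hpq hn'
  have t4 : ‖(Nat.factorial 4 : ℂ)⁻¹ • pow (α + F) 4‖ ^ 2 =
      ‖pfaffianTop (blockSkew p n n')‖ ^ 2 := by
    rw [h1, ← pullback_cpow, ← pullback_smul, ← n4]
    exact norm_sq_pullback_top hT hV _
  have t3 : ‖bracketProj J 4 2 ((Nat.factorial 3 : ℂ)⁻¹ • pow (α + F) 3)‖ ^ 2 =
      ∑ i, ‖pfaffianSixAt (blockSkew p n n') (sixIndex i)‖ ^ 2 := by
    rw [h1, ← pullback_cpow, ← pullback_smul]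
    exact (norm_sq_bracketProj_six hT hV hTJ _).trans
      (Finset.sum_congr rfl fun i _ => congrArg (· ^ 2) (n3 (sixIndex i)))
  have t2 : ‖bracketProj J 4 0 ((Nat.factorial 2 : ℂ)⁻¹ • pow (α + F) 2)‖ ^ 2 =
      ∑ i, ‖pfaffianFourAt (blockSkew p n n') (fourIndex i)‖ ^ 2 := by
    rw [h1, ← pullback_cpow, ← pullback_smul]
    exact (norm_sq_bracketProj_four hT hV hTJ _).trans
      (Finset.sum_congr rfl fun i _ => congrArg (· ^ 2) (n2 (fourIndex i)))
  have e := eq_skewFour hn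
  have e' := eq_skewFour hns
  refine ⟨?_, ?_⟩
  · rw [t4, t3, t2, ← Complex.ofReal_inj, det_id_add hT hc hn' hK hV]
    push_cast
    simp only [← Complex.ofReal_pow, m4, m3, m2]
    rw [e, e', det_fromBlocks_skewFour p q hp fun i => by simp [p, q]; ring]
  · rw [h0, bracketProj_two_eq_zero_iff hT hV hTJ, ← norm_eq_zero, ← sq_eq_zero_iff, t3,
      ← norm_eq_zero (a := bracketProj J 4 0 _), ← sq_eq_zero_iff (a := ‖bracketProj J 4 0 _‖), t2,
      Finset.sum_eq_zero_iff_of_nonneg fun _ _ => by positivity,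
      Finset.sum_eq_zero_iff_of_nonneg fun _ _ => by positivity]
    have hs {k : ℕ} (c : ℂ) (δ : (Fin 4 ⊕ Fin 4 → ℂ) [⋀^Fin k]→ₗ[ℂ] ℂ) (g) :
      comp (c • δ) g = c * comp δ g := rfl
    simp only [Finset.mem_univ, true_imp_iff, sq_eq_zero_iff, norm_eq_zero, hs, hcomp]
    constructor
    · rintro ⟨h6, h4⟩
      rw [e, e'] at h6 h4
      have hz := skewFour_eq_zero hp h6 h4
      have hz' : n = 0 := by
        rw [e, hz.1, hz.2.1, hz.2.2.1, hz.2.2.2.1, hz.2.2.2.2.1, hz.2.2.2.2.2]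
        ext i j
        fin_cases i <;> fin_cases j <;> simp [skewFour]
      intro j k
      simp [blockSkew, ← hn', hz']
    · intro h
      -- The (0,2)-components of F alone determine n; the (2,0)-ones are governed by its conjugate.
      have hz' (j k) : n j k = 0 := by simpa [blockSkew] using (h j k).2
      have hz (j k) : n' j k = 0 := by rw [← hn', hz', map_zero]
      refine ⟨?_, ?_⟩
      · rintro ⟨i, b⟩
        fin_cases i <;> cases b <;>
          simp [pfaffianSixAt, pfaffianSix, pfaffianFour, sixIndex, blockSkew, hz, hz']
      · intro b
        cases b <;> simp [pfaffianFourAt, pfaffianFour, fourIndex, blockSkew, hz, hz']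

end CForm

end PointwiseIdentity

/-! ### The curvature of a Hermitian connection is imaginary -/

section Curvature

open VectorField Bundle

variable {E : Type*} [NormedAddCommGroup E] [NormedSpace ℝ E] [FiniteDimensional ℝ E]
  {X : Type*} [TopologicalSpace X] [ChartedSpace E X] [IsManifold 𝓘(ℝ, E) ∞ X]

lemma exists_smoothField [T2Space X] (x : X) (v : TangentSpace 𝓘(ℝ, E) x) :
    ∃ V : (x : X) → TangentSpace 𝓘(ℝ, E) x, SmoothField V ∧ V x = v := by
  obtain ⟨u, hu, hs⟩ := FiberBundle.exists_contMDiffOn_extend (k := ∞) 𝓘(ℝ, E) E v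
  obtain ⟨w, hwu, hw, hxw⟩ := mem_nhds_iff.1 hu
  obtain ⟨f, hfw, -⟩ := (SmoothBumpFunction.nhds_basis_support (I := 𝓘(ℝ, E))
    (hw.mem_nhds hxw)).mem_iff.1 (hw.mem_nhds hxw)
  refine ⟨fun y => f y • FiberBundle.extend E v y, ?_, ?_⟩
  · exact ContMDiffOn.smul_section_of_tsupport f.contMDiff.contMDiffOn hw hfw (hs.mono hwu)
  · simp

variable {L : X → Type*} [TopologicalSpace (TotalSpace ℂ L)] [∀ x, NormedAddCommGroup (L x)]
  [∀ x, InnerProductSpace ℂ (L x)] [FiberBundle ℂ L] [VectorBundle ℂ ℂ L]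
  [ContMDiffVectorBundle ∞ ℂ L 𝓘(ℝ, E)] {nabla : CovariantDerivative 𝓘(ℝ, E) ℂ L}
  {s t : (x : X) → L x}

omit [FiniteDimensional ℝ E] in
lemma SmoothField.diffAt {V : (x : X) → TangentSpace 𝓘(ℝ, E) x} (hV : SmoothField V) (x : X) :
    DiffFieldAt V x :=
  hV.mdifferentiableAt (by simp)

omit [FiniteDimensional ℝ E] [ContMDiffVectorBundle ∞ ℂ L 𝓘(ℝ, E)] in
lemma IsHermitianConnection.smoothSection (h : IsHermitianConnection nabla)
    (hs : SmoothSection E s) {V : (x : X) → TangentSpace 𝓘(ℝ, E) x} (hV : SmoothField V) :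
    SmoothSection E (fun y => nabla s y (V y)) := by
  have h1 := h.smooth.contMDiff.contMDiff (σ := s) (by simpa using hs.contMDiffOn)
  exact ContMDiff.clm_bundle_apply (contMDiffOn_univ.1 h1) hV

omit [FiniteDimensional ℝ E] in
lemma IsHermitianConnection.mvfderiv_re_inner (h : IsHermitianConnection nabla)
    (hL : IsSmoothHermitianMetric E L) (hs : SmoothSection E s) (ht : SmoothSection E t) (x : X)
    (v : TangentSpace 𝓘(ℝ, E) x) :
    mvfderiv 𝓘(ℝ, E) (fun y => (inner ℂ (s y) (t y) : ℂ).re) x v =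
      (inner ℂ (nabla s x v) (t x) + inner ℂ (s x) (nabla t x v) : ℂ).re := by
  rw [← h.metric s t x (hs.diffAt x) (ht.diffAt x) v]
  have h1 := mfderiv_comp x (I := 𝓘(ℝ, E)) (I' := 𝓘(ℝ, ℂ)) (I'' := 𝓘(ℝ, ℝ))
    (Complex.reCLM.mdifferentiableAt (x := (inner ℂ (s x) (t x) : ℂ)))
    ((hL s t hs ht).mdifferentiableAt (by simp) : MDifferentiableAt 𝓘(ℝ, E) 𝓘(ℝ, ℂ)
      (fun y => (inner ℂ (s y) (t y) : ℂ)) x)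
  rw [ContinuousLinearMap.mfderiv_eq] at h1
  exact DFunLike.congr_fun h1 v

/-- The curvature of a Hermitian connection has imaginary values. -/
lemma IsHermitianConnection.curvature_re [T2Space X] (h : IsHermitianConnection nabla)
    (hL : IsSmoothHermitianMetric E L) (x : X) (u v : TangentSpace 𝓘(ℝ, E) x) :
    (h.curvature x ![u, v]).re = 0 := by
  obtain ⟨s, hs, hsx, -⟩ := exists_frame (E := E) (L := L) x
  obtain ⟨U, hU, rfl⟩ := exists_smoothField x u
  obtain ⟨V, hV, rfl⟩ := exists_smoothField x v
  have : CompleteSpace E := FiniteDimensional.complete ℝ E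
  have hf : ContMDiff 𝓘(ℝ, E) 𝓘(ℝ, ℝ) ∞ fun y => (inner ℂ (s y) (s y) : ℂ).re :=
    Complex.reCLM.contMDiff.comp (hL s s hs hs)
  have hsymm {y : X} (a b : L y) : (inner ℂ a b : ℂ).re = (inner ℂ b a : ℂ).re := by
    rw [← inner_conj_symm, Complex.conj_re]
  have hd (y : X) (w : TangentSpace 𝓘(ℝ, E) y) :
      mvfderiv 𝓘(ℝ, E) (fun y => (inner ℂ (s y) (s y) : ℂ).re) y w =
        2 * (inner ℂ (nabla s y w) (s y) : ℂ).re := by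
    rw [h.mvfderiv_re_inner hL hs hs, Complex.add_re, hsymm (s y), two_mul]
  have hd2 {W : (x : X) → TangentSpace 𝓘(ℝ, E) x} (hW : SmoothField W)
      (w : TangentSpace 𝓘(ℝ, E) x) :
      mvfderiv 𝓘(ℝ, E)
        (fun y => mvfderiv 𝓘(ℝ, E) (fun y => (inner ℂ (s y) (s y) : ℂ).re) y (W y)) x w =
      2 * (inner ℂ (nabla (fun y => nabla s y (W y)) x w) (s x) +
        inner ℂ (nabla s x (W x)) (nabla s x w) : ℂ).re := by
    have h2 : (fun y => mvfderiv 𝓘(ℝ, E) (fun y => (inner ℂ (s y) (s y) : ℂ).re) y (W y)) =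
        (fun y => (inner ℂ (nabla s y (W y)) (s y) : ℂ).re) +
          fun y => (inner ℂ (nabla s y (W y)) (s y) : ℂ).re := by
      ext y
      rw [hd, two_mul]; rfl
    have hW' := h.smoothSection hs hW
    have hg : MDifferentiableAt 𝓘(ℝ, E) 𝓘(ℝ, ℝ)
        (fun y => (inner ℂ (nabla s y (W y)) (s y) : ℂ).re) x :=
      (Complex.reCLM.contMDiff.comp (hL _ s hW' hs)).mdifferentiableAt (n := ∞) (by simp)
    rw [h2, mvfderiv_add hg hg, add_apply, h.mvfderiv_re_inner hL hW' hs, two_mul]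
  -- For f = |s|², the identity [U, V]f = UVf - VUf holds. Two derivatives of f along U and V
  -- produce the term Re⟨∇_U s, ∇_V s⟩ in both orders; these cancel, and there remains Re⟨R(U, V)s,
  -- s⟩ = 0. Since s(x) ≠ 0, the real part of F(U, V) vanishes.
  have hlie := (lie_deriv_aux hf.contMDiffAt (hU.diffAt x) (hV.diffAt x)).2
  rw [hd, hd2 hV, hd2 hU, Complex.add_re, Complex.add_re, hsymm (nabla s x (V x))] at hlie
  have hc := h.isCurvatureAt x s U V hs (hU.diffAt x) (hV.diffAt x)
  have h3 : (inner ℂ (curvOp nabla s U V x) (s x) : ℂ).re = 0 := by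
    rw [curvOp, inner_sub_left, inner_sub_left, Complex.sub_re, Complex.sub_re]
    linarith
  rw [hc, inner_smul_left, inner_self_eq_norm_sq_to_K] at h3
  have hne : ‖s x‖ ≠ 0 := norm_ne_zero_iff.2 hsx
  have h4 : (h.curvature x ![U x, V x]).re * ‖s x‖ ^ 2 = 0 := by
    rw [← h3]
    simp [← Complex.ofReal_pow]
  exact (mul_eq_zero.1 h4).resolve_right (pow_ne_zero 2 hne)

end Curvature

/-! ### The phase inequality and its equality case -/

section Phase

/-- The difference D - a² = b² + 2c² + 8d² is a positive combination of squares. -/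
lemma le_sqrt_and_eq_sqrt_iff {a b c d D N : ℝ} (ha : 0 ≤ a) (hN : N ^ 2 = a ^ 2 + b ^ 2)
    (hD : N ^ 2 + 2 * c ^ 2 + 8 * d ^ 2 = D) : a ≤ √D ∧ (a = √D ↔ (c = 0 ∧ d = 0) ∧ b = 0) := by
  have hb := sq_nonneg b
  have hc := sq_nonneg c
  have hd := sq_nonneg d
  have ha2 := sq_nonneg a
  refine ⟨Real.le_sqrt_of_sq_le (by linarith), ?_⟩
  rw [eq_comm, Real.sqrt_eq_iff_eq_sq (by linarith) ha]
  constructor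
  · intro h
    exact ⟨⟨sq_eq_zero_iff.1 (by linarith), sq_eq_zero_iff.1 (by linarith)⟩,
      sq_eq_zero_iff.1 (by linarith)⟩
  · rintro ⟨⟨rfl, rfl⟩, rfl⟩
    linarith

namespace CForm

variable {V : Type*} [NormedAddCommGroup V] [InnerProductSpace ℝ V]

/-- Serves to drop the factor 1/4!, which is absent from the dHYM equation. -/
lemma im_smul_eq_zero_iff {k : ℕ} {r : ℝ} (hr : r ≠ 0) (c : ℂ) (α : CForm V k) :
    im (c • ((r : ℂ) • α)) = 0 ↔ im (c • α) = 0 := by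
  have h : im (c • ((r : ℂ) • α)) = r • im (c • α) := by
    ext v
    change ((c * (r * α v)).im : ℂ) = r • ((c * α v).im : ℂ)
    rw [mul_left_comm, Complex.im_ofReal_mul, Complex.ofReal_mul, Complex.real_smul]
  rw [h, smul_eq_zero_iff_right hr]

variable [FiniteDimensional ℝ V]

lemma norm_sq_re_add_norm_sq_im {k : ℕ} (α : CForm V k) : ‖re α‖ ^ 2 + ‖im α‖ ^ 2 = ‖α‖ ^ 2 := by
  rw [norm_sq_eq, norm_sq_eq, norm_sq_eq, ← mul_add, ← Finset.sum_add_distrib]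
  congr 1
  refine Finset.sum_congr rfl fun f _ => ?_
  change ‖((α.coeff f).re : ℂ)‖ ^ 2 + ‖((α.coeff f).im : ℂ)‖ ^ 2 = _
  rw [Complex.norm_real, Complex.norm_real, Complex.sq_norm, Complex.normSq_apply,
    Real.norm_eq_abs, Real.norm_eq_abs, sq_abs, sq_abs]
  ring

lemma norm_sq_eq_of_phase (θ : ℝ) {k : ℕ} (α : CForm V k) :
    ‖α‖ ^ 2 = ‖re (Complex.exp (-(θ * Complex.I)) • α)‖ ^ 2 +
      ‖im (Complex.exp (-(θ * Complex.I)) • α)‖ ^ 2 := by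
  rw [norm_sq_re_add_norm_sq_im, norm_smul, ← neg_mul, ← Complex.ofReal_neg,
    Complex.norm_exp_ofReal_mul_I, one_mul]

/-- The inequality and the equality case for a Kähler form `α` and a `2`-form `F` with values in
`iℝ`, on a Hermitian vector space of complex dimension `4`. -/
theorem norm_re_pow_add_le (hV : finrank ℝ V = 8) {J : V →ₗ[ℝ] V} (hJ2 : ∀ v, J (J v) = -v)
    (hJ : ∀ u v, inner ℝ (J u) (J v) = inner ℝ u v) {α F : CForm V 2}
    (hα : ∀ u v, α ![u, v] = (inner ℝ (J u) v : ℝ)) (hF : ∀ u v, (F ![u, v]).re = 0) (θ : ℝ) :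
    ‖re (Complex.exp (-(θ * Complex.I)) • ((Nat.factorial 4 : ℂ)⁻¹ • pow (α + F) 4))‖ ≤
        √(LinearMap.det (LinearMap.id + sharp F)) ∧
      (‖re (Complex.exp (-(θ * Complex.I)) • ((Nat.factorial 4 : ℂ)⁻¹ • pow (α + F) 4))‖ =
          √(LinearMap.det (LinearMap.id + sharp F)) ↔
        bracketProj J 2 0 (-Complex.I • F) = 0 ∧
          im (Complex.exp (-(θ * Complex.I)) • pow (α + F) 4) = 0) := by
  obtain ⟨hdet, hproj⟩ := norm_sq_pow_add hV hJ2 hJ hα hF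
  have him := im_smul_eq_zero_iff (r := (Nat.factorial 4 : ℝ)⁻¹) (by positivity)
    (Complex.exp (-(θ * Complex.I))) (pow (α + F) 4)
  rw [Complex.ofReal_inv, Complex.ofReal_natCast] at him
  have h := le_sqrt_and_eq_sqrt_iff (norm_nonneg _)
    (norm_sq_eq_of_phase θ ((Nat.factorial 4 : ℂ)⁻¹ • pow (α + F) 4)) hdet
  refine ⟨h.1, h.2.trans ?_⟩
  rw [← him, ← hproj, norm_eq_zero, norm_eq_zero, norm_eq_zero]

end CForm

end Phase

end

/-! ### The theorem, one tangent space at a time -/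

theorem theorem6p2 {E : Type*} [NormedAddCommGroup E] [NormedSpace ℂ E] [FiniteDimensional ℂ E]
    (hE : finrank ℂ E = 4)
    {X : Type*} [TopologicalSpace X] [T2Space X] [SecondCountableTopology X] [ChartedSpace E X]
    [IsManifold 𝓘(ℂ, E) ∞ X]
    [Bundle.RiemannianBundle (fun x : X => TangentSpace 𝓘(ℝ, E) x)]
    [IsContMDiffRiemannianBundle 𝓘(ℝ, E) ∞ E (fun x : X => TangentSpace 𝓘(ℝ, E) x)]
    (hK : IsKahler E X)
    {L : X → Type*} [TopologicalSpace (Bundle.TotalSpace ℂ L)] [∀ x, NormedAddCommGroup (L x)]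
    [∀ x, InnerProductSpace ℂ (L x)] [FiberBundle ℂ L] [VectorBundle ℂ ℂ L]
    [ContMDiffVectorBundle ∞ ℂ L 𝓘(ℝ, E)] (hL : IsSmoothHermitianMetric E L)
    (nabla : CovariantDerivative 𝓘(ℝ, E) ℂ L) (h : IsHermitianConnection nabla) :
    (∀ x : X,
      ‖(Nat.factorial 4 : ℂ)⁻¹ • totalPow hK h 4 x‖ ^ 2
        + 2 * ‖CForm.bracketProj (complexStr E x) 4 2
            ((Nat.factorial 3 : ℂ)⁻¹ • totalPow hK h 3 x)‖ ^ 2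
        + 8 * ‖CForm.bracketProj (complexStr E x) 4 0
            ((Nat.factorial 2 : ℂ)⁻¹ • totalPow hK h 2 x)‖ ^ 2
        = LinearMap.det (LinearMap.id + CForm.sharp (h.curvatureForm x))) ∧
    ∀ θ : ℝ,
      (∀ x : X,
        ‖CForm.re (Complex.exp (-(θ * Complex.I)) •
            ((Nat.factorial 4 : ℂ)⁻¹ • totalPow hK h 4 x))‖
          ≤ √(LinearMap.det (LinearMap.id + CForm.sharp (h.curvatureForm x)))) ∧
      ((∀ x : X,
        ‖CForm.re (Complex.exp (-(θ * Complex.I)) •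
            ((Nat.factorial 4 : ℂ)⁻¹ • totalPow hK h 4 x))‖
          = √(LinearMap.det (LinearMap.id + CForm.sharp (h.curvatureForm x)))) ↔
        IsDHYM hK h θ) := by
  have hV (x : X) : finrank ℝ (TangentSpace 𝓘(ℝ, E) x) = 8 := by
    have h1 := finrank_real_of_complex E
    rw [hE] at h1
    exact h1
  have hF (x : X) (u v) : (h.curvatureForm x ![u, v]).re = 0 := h.curvature_re hL x u v
  have hpt (x : X) := CForm.norm_sq_pow_add (hV x) (complexStr_sq x) (hK.inner_complexStr x)
    (hK.form_apply x) (hF x)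
  have hre (x : X) := CForm.norm_re_pow_add_le (hV x) (complexStr_sq x) (hK.inner_complexStr x)
    (hK.form_apply x) (hF x)
  have hpow (r : ℕ) (x : X) :
    totalPow hK h r x = CForm.pow (hK.form x + h.curvatureForm x) r := rfl
  refine ⟨fun x => ?_, fun θ => ⟨fun x => ?_, ?_⟩⟩
  · rw [hpow, hpow, hpow, ← (hpt x).1]
  · rw [hpow]
    exact (hre x θ).1
  -- The dHYM condition and the equality are both imposed at every point, so the pointwise
  -- equivalence suffices; `hE` turns the exponent of ω + F into 4.
  · rw [IsDHYM, hE]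
    refine forall_congr' fun x => ?_
    rw [hpow]
    exact (hre x θ).2
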